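/- Let $X$ and $V$ be complex Hilbert spaces with $V\subset X$ densely and continuously embedded; write $a(\cdot,\cdot)$ for the inner product of $V$, $V'$ for the space of continuous antilinear functionals on $V$ (with pivot space $X$), and $A\in\mathcal L(V,V')$ for the operator $\langle Ax,\varphi\rangle=a(x,\varphi)$. Let $U,W$ be complex Hilbert spaces (identified with their duals), and let $B\in\mathcal L(U,V')$ with adjoint $B^*\in\mathcal L(V,U)$. Let $C$ be a skew-adjoint operator on $U$ and let $D\in\mathcal L(W,\mathcal D(C)')$, with adjoint $D^*\in\mathcal L(\mathcal D(C),W)$, where $\mathcal D(C)$ carries the graph norm. For $u\in U$ we also write $$D^*u=\lim_{\varepsilon\to0^+}D^*(1-\varepsilon^2C^2)^{-1}u$$ whenever this limit exists in $W$; this extends $D^*$ beyond $\mathcal D(C)$. Let $\widehat C$ be an m-dissipative operator on $U$ with $\widehat C=-C-DD^*$, that is, $u\in\mathcal D(\widehat C)$ and $\widehat Cu=f$ if and only if $u,f\in U$, $D^*u$ is defined and $f=-Cu-DD^*u$ in $\mathcal D(C)'$. On $\mathcal H=V\times X\times U$ with $\|(x,y,u)\|_{\mathcal H}^2=a(x,x)+\|y\|_X^2+\|u\|_U^2$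 define $$\mathcal A_d(x,y,u)=(y,-Ax-Bu,B^*y+\widehat Cu),\quad \mathcal D(\mathcal A_d)=\{(x,y,u)\in V\times V\times\mathcal D(\widehat C):Ax+Bu\in X\},$$ $$\mathcal A_c(x,y,u)=(y,-Ax-Bu,B^*y-Cu),\quad \mathcal D(\mathcal A_c)=\{(x,y,u)\in V\times V\times\mathcal D(C):Ax+Bu\in X\}.$$ Assume that $D$ is bounded, i.e. $D\in\mathcal L(W,U)$, or that the following holds: (H) for every $\lambda\in\mathbb C$ with $\operatorname{Re}\lambda>0$ the transfer function $$H(\lambda)=-D^*\bigl(\lambda I+C+\lambda B^*(\lambda^2+A)^{-1}B\bigr)^{-1}D$$ is well defined and belongs to $\mathcal L(W)$, and for some $\beta>0$ it is bounded on the line $\operatorname{Re}\lambda=\beta$. Then the following are equivalent. 1. The damped system $z'(t)=\mathcal A_dz(t)$, $z(0)=z_0$, is exponentially stable: there are constants $c,\omega>0$ such that for all $z_0\in\mathcal D(\mathcal A_d)$ the classical solution $z\in C([0,\infty),\mathcal D(\mathcal A_d))\cap C^1([0,\infty),\mathcal H)$ satisfies $E(t)\le c\,e^{-\omega t}E(0)$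 for all $t\ge0$, where $E(t)=\tfrac12\|z(t)\|_{\mathcal H}^2$. 2. There is a constant $\delta>0$ such that for all $w\in\mathbb R$ and all $z=(x,y,u)\in\mathcal D(\mathcal A_c)$, $$\|(iw-\mathcal A_c)z\|_{\mathcal H}^2+\|D^*u\|_W^2\ge\delta\|z\|_{\mathcal H}^2 .$$ -/

import Mathlib

open Filter Topology

noncomputable section

/-! ### Operators on a Hilbert space -/

section Operators

variable {E : Type*} [NormedAddCommGroup E] [InnerProductSpace ℂ E]

/-- `T` is densely defined and `T† = -T` (equality of unbounded operators, domains included). -/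
def IsSkewAdjointOp [CompleteSpace E] (T : E →ₗ.[ℂ] E) : Prop :=
  Dense (T.domain : Set E) ∧ T.adjoint = -T

/-- `T` is dissipative and `μ - T` is onto for some `μ > 0`. -/
def IsMDissipativeOp (T : E →ₗ.[ℂ] E) : Prop :=
  (∀ u : T.domain, (inner ℂ (u : E) (T u)).re ≤ 0) ∧
    ∃ μ : ℝ, 0 < μ ∧ ∀ f : E, ∃ u : T.domain, (μ : ℂ) • (u : E) - T u = f

/-- Classical solutions of `z' = T z` on `[0, ∞)`:
`z ∈ C([0,∞), D(T)) ∩ C¹([0,∞), E)`, with the graph norm on `D(T)`. -/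
def IsClassicalSolution (T : E →ₗ.[ℂ] E) (z : ℝ → E) : Prop :=
  ∃ z' : ℝ → E, ContinuousOn z' (Set.Ici 0) ∧
    ∀ t : ℝ, 0 ≤ t → (z t, z' t) ∈ T.graph ∧ HasDerivWithinAt z (z' t) (Set.Ici 0) t

/-- Exponential decay of the energy `½ ‖z(t)‖²` of the solution of `z' = T z`, `z(0) = z₀`, with
constants that do not depend on `z₀ ∈ D(T)`. -/
def IsExponentiallyStable (T : E →ₗ.[ℂ] E) : Prop :=
  ∃ c ω : ℝ, 0 < c ∧ 0 < ω ∧ ∀ z₀ : T.domain, ∀ z : ℝ → E,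
    IsClassicalSolution T z → z 0 = z₀ → ∀ t : ℝ, 0 ≤ t →
      (1 / 2) * ‖z t‖ ^ 2 ≤ c * Real.exp (-ω * t) * ((1 / 2) * ‖z 0‖ ^ 2)

end Operators

/-! ### The coupled system -/

section System

variable {V X U W : Type*}
  [NormedAddCommGroup V] [InnerProductSpace ℂ V]
  [NormedAddCommGroup X] [InnerProductSpace ℂ X]
  [NormedAddCommGroup U] [InnerProductSpace ℂ U]
  [NormedAddCommGroup W] [InnerProductSpace ℂ W]

/-- The energy space `V × X × U` with its Hilbert (`ℓ²`) norm
`‖(x, y, u)‖² = a(x, x) + ‖y‖² + ‖u‖²`; the form `a` is the inner product of `V`. -/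
abbrev EnergySpace (V X U : Type*) [NormedAddCommGroup V] [InnerProductSpace ℂ V]
    [NormedAddCommGroup X] [InnerProductSpace ℂ X]
    [NormedAddCommGroup U] [InnerProductSpace ℂ U] : Type _ :=
  WithLp 2 (V × WithLp 2 (X × U))

/-- The adjoint `B* ∈ L(V, U)` of `B ∈ L(U, V')`, where `V'` is the space of continuous
antilinear functionals on `V`: `⟨Bu, φ⟩ = ⟨u, B*φ⟩`. -/
def adjointControl [CompleteSpace U] (B : U →L[ℂ] (V →L⋆[ℂ] ℂ)) : V →L[ℂ] U :=
  (InnerProductSpace.toDual ℂ U).symm.toContinuousLinearEquiv.toContinuousLinearMap.comp B.flip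

theorem inner_adjointControl [CompleteSpace U] (B : U →L[ℂ] (V →L⋆[ℂ] ℂ)) (φ : V) (u : U) :
    inner ℂ (adjointControl B φ) u = B u φ := by
  simp [adjointControl]

/-- Graph of `(x, y, u) ↦ (y, -Ax - Bu, B*y + Ku)` with domain
`{(x, y, u) ∈ V × V × D(K) : Ax + Bu ∈ X}`. Here `A : V → V'` is `⟨Ax, φ⟩ = a(x, φ)`, and `V` is a
subspace of `X` through `ι`. -/
def systemGraph [CompleteSpace U] (ι : V →L[ℂ] X) (B : U →L[ℂ] (V →L⋆[ℂ] ℂ))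
    (K : U →ₗ.[ℂ] U) : Submodule ℂ (EnergySpace V X U × EnergySpace V X U) where
  carrier := {p | ∃ y : V, ι y = p.1.snd.fst ∧ p.2.fst = y ∧
    (∀ φ : V, inner ℂ (ι φ) p.2.snd.fst = -(inner ℂ φ p.1.fst + B p.1.snd.snd φ)) ∧
    (p.1.snd.snd, p.2.snd.snd - adjointControl B y) ∈ K.graph}
  zero_mem' := ⟨0, by simp, by simp, by simp, by simp⟩
  add_mem' := by
    rintro p q ⟨y, h1, h2, h3, h4⟩ ⟨y', k1, k2, k3, k4⟩
    refine ⟨y + y', by simp [h1, k1], by simp [h2, k2], fun φ => ?_, ?_⟩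
    · have := h3 φ
      have := k3 φ
      simp [*]
      ring
    · have h := K.graph.add_mem h4 k4
      have e : (p + q).2.snd.snd - adjointControl B (y + y') =
          (p.2.snd.snd - adjointControl B y) + (q.2.snd.snd - adjointControl B y') := by
        simp
        abel
      rw [e]
      simpa using h
  smul_mem' := by
    rintro c p ⟨y, h1, h2, h3, h4⟩
    refine ⟨c • y, by simp [h1], by simp [h2], fun φ => ?_, ?_⟩
    · have := h3 φ
      simp [*]
      ring
    · have h := K.graph.smul_mem c h4
      have e : (c • p).2.snd.snd - adjointControl B (c • y) =
          c • (p.2.snd.snd - adjointControl B y) := by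
        simp [smul_sub]
      rw [e]
      simpa using h

/-- The operator `(x, y, u) ↦ (y, -Ax - Bu, B*y + Ku)` on the energy space. -/
def systemOp [CompleteSpace U] (ι : V →L[ℂ] X) (B : U →L[ℂ] (V →L⋆[ℂ] ℂ))
    (K : U →ₗ.[ℂ] U) : EnergySpace V X U →ₗ.[ℂ] EnergySpace V X U :=
  (systemGraph ι B K).toLinearPMap

/-- `systemGraph` really is the graph of `systemOp`. -/
theorem systemOp_graph [CompleteSpace U] (ι : V →L[ℂ] X) (hι : Function.Injective ι)
    (hd : DenseRange ι) (B : U →L[ℂ] (V →L⋆[ℂ] ℂ)) (K : U →ₗ.[ℂ] U) :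
    (systemOp ι B K).graph = systemGraph ι B K := by
  refine Submodule.toLinearPMap_graph_eq _ ?_
  rintro ⟨p, q⟩ ⟨y, h1, h2, h3, h4⟩ hp
  obtain rfl : p = 0 := hp
  have hy : y = 0 := hι (by simpa using h1)
  subst hy
  have e3 : q.snd.snd = 0 := by
    have := K.graph_fst_eq_zero_snd h4 (by simp)
    simpa using this
  have e2 : q.snd.fst = 0 := by
    refine Dense.eq_zero_of_inner_left (𝕜 := ℂ) hd ?_
    rintro _ ⟨φ, rfl⟩
    rw [← inner_conj_symm]
    have := h3 φ
    simp_all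
  have e1 : q.fst = 0 := by simpa using h2
  change q = 0
  refine (WithLp.ofLp_injective 2) (Prod.ext e1 ?_)
  exact (WithLp.ofLp_injective 2) (Prod.ext e2 e3)

/-- The generator of the undamped system: `(x, y, u) ↦ (y, -Ax - Bu, B*y - Cu)`. -/
def conservativeOp [CompleteSpace U] (ι : V →L[ℂ] X) (B : U →L[ℂ] (V →L⋆[ℂ] ℂ))
    (C : U →ₗ.[ℂ] U) : EnergySpace V X U →ₗ.[ℂ] EnergySpace V X U :=
  systemOp ι B (-C)

/-- The generator of the damped system: `(x, y, u) ↦ (y, -Ax - Bu, B*y + Ĉu)`. -/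
def dampedOp [CompleteSpace U] (ι : V →L[ℂ] X) (B : U →L[ℂ] (V →L⋆[ℂ] ℂ))
    (Chat : U →ₗ.[ℂ] U) : EnergySpace V X U →ₗ.[ℂ] EnergySpace V X U :=
  systemOp ι B Chat

theorem conservativeOp_third_mem [CompleteSpace U] (ι : V →L[ℂ] X)
    (B : U →L[ℂ] (V →L⋆[ℂ] ℂ)) (C : U →ₗ.[ℂ] U)
    (z : (conservativeOp ι B C).domain) : (z : EnergySpace V X U).snd.snd ∈ C.domain := by
  obtain ⟨z, hz⟩ := z
  obtain ⟨p, ⟨y, -, -, -, h4⟩, rfl⟩ := hz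
  have h : p.1.snd.snd ∈ (-C).domain := LinearPMap.mem_domain_of_mem_graph h4
  exact h

/-- `D* ∈ L(D(C), W)` for the graph norm of `D(C)`; equivalently `D ∈ L(W, D(C)')`, where
`⟨Dw, v⟩ = ⟨w, D*v⟩` for `v ∈ D(C)`. -/
def IsGraphBounded (C : U →ₗ.[ℂ] U) (Dst : C.domain →ₗ[ℂ] W) : Prop :=
  ∃ M : ℝ, ∀ v : C.domain, ‖Dst v‖ ^ 2 ≤ M * (‖(v : U)‖ ^ 2 + ‖C v‖ ^ 2)

/-- `D` is a bounded operator from `W` to `U`. -/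
def IsBoundedControl (C : U →ₗ.[ℂ] U) (Dst : C.domain →ₗ[ℂ] W) : Prop :=
  ∃ D : W →L[ℂ] U, ∀ (w : W) (v : C.domain), inner ℂ (v : U) (D w) = inner ℂ (Dst v) w

/-- `D*u = y` for `u ∈ U` that need not lie in `D(C)`: the value
`D*u = lim D* (1 - ε²C²)⁻¹ u` as `ε → 0+`, whenever this limit exists in `W`. The
regularisations `(1 - ε²C²)⁻¹ u` lie in `D(C²)` and tend to `u` in `U`, and in `D(C)` if `u` is in
`D(C)`. So this extends `D*`, and it gives the extension by continuity of `D*` to each space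
between `D(C)` and `U` in which these regularisations converge (such as `D(|C|^{1/2})`). -/
def HasDualValue (C : U →ₗ.[ℂ] U) (Dst : C.domain →ₗ[ℂ] W) (u : U) (y : W) : Prop :=
  ∃ v : ℝ → C.domain,
    (∀ ε : ℝ, 0 < ε → ∃ h : C (v ε) ∈ C.domain,
      (v ε : U) - ((ε : ℂ) ^ 2) • C ⟨C (v ε), h⟩ = u) ∧
    Tendsto (fun ε => Dst (v ε)) (𝓝[>] 0) (𝓝 y)

/-- `Ĉ = -C - DD*`, where the sum is computed in `D(C)'` and `D(Ĉ)` consists of all `u`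
for which `D*u` is defined and `-Cu - DD*u` belongs to `U`. In `D(C)'` one has
`⟨-Cu, v⟩ = ⟨u, Cv⟩` and `⟨DD*u, v⟩ = ⟨D*u, D*v⟩`. -/
def IsMinusSkewMinusDDStar (Chat C : U →ₗ.[ℂ] U) (Dst : C.domain →ₗ[ℂ] W) : Prop :=
  ∀ u f : U, (u, f) ∈ Chat.graph ↔
    ∃ y : W, HasDualValue C Dst u y ∧
      ∀ v : C.domain, inner ℂ (v : U) f = inner ℂ (C v) u - inner ℂ (Dst v) y

/-- `u = (λ + C + λ B*(λ² + A)⁻¹B)⁻¹ D w`. Here `x = (λ² + A)⁻¹ B u` is the element of `V` with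
`(A + λ²) x = Bu` in `V'`, and the equation for `u` holds in `D(C)'`. -/
def SolvesTransfer [CompleteSpace U] (ι : V →L[ℂ] X) (B : U →L[ℂ] (V →L⋆[ℂ] ℂ))
    (C : U →ₗ.[ℂ] U) (Dst : C.domain →ₗ[ℂ] W) (l : ℂ) (w : W) (u : U) : Prop :=
  ∃ x : V, (∀ φ : V, inner ℂ φ x + l ^ 2 * inner ℂ (ι φ) (ι x) = B u φ) ∧
    ∀ v : C.domain,
      l * inner ℂ (v : U) u - inner ℂ (C v) u + l * inner ℂ (v : U) (adjointControl B x) =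
        inner ℂ (Dst v) w

/-- The transfer function estimate: on the open right half-plane
`H(λ) = -D*(λ + C + λ B*(λ² + A)⁻¹B)⁻¹ D` is an element of `L(W)`, and it is bounded
on some line `Re λ = β`, `β > 0`. -/
def TransferEstimate [CompleteSpace U] (ι : V →L[ℂ] X) (B : U →L[ℂ] (V →L⋆[ℂ] ℂ))
    (C : U →ₗ.[ℂ] U) (Dst : C.domain →ₗ[ℂ] W) : Prop :=
  ∃ H : ℂ → (W →L[ℂ] W),
    (∀ l : ℂ, 0 < l.re → ∀ w : W, ∃ u : U,
      SolvesTransfer ι B C Dst l w u ∧ HasDualValue C Dst u (-(H l w))) ∧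
    ∃ β : ℝ, 0 < β ∧ ∃ M : ℝ, ∀ l : ℂ, l.re = β → ‖H l‖ ≤ M

/-- The Hautus-type estimate
`‖(iw - 𝒜_c) z‖² + ‖D*u‖² ≥ δ ‖z‖²`, `w ∈ ℝ`, `z = (x, y, u) ∈ D(𝒜_c)`. -/
def HautusEstimate [CompleteSpace U] (ι : V →L[ℂ] X) (B : U →L[ℂ] (V →L⋆[ℂ] ℂ))
    (C : U →ₗ.[ℂ] U) (Dst : C.domain →ₗ[ℂ] W) : Prop :=
  ∃ δ : ℝ, 0 < δ ∧ ∀ (w : ℝ) (z : (conservativeOp ι B C).domain),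
    ‖(Complex.I * (w : ℂ)) • (z : EnergySpace V X U) - conservativeOp ι B C z‖ ^ 2 +
      ‖Dst ⟨(z : EnergySpace V X U).snd.snd, conservativeOp_third_mem ι B C z⟩‖ ^ 2 ≥
      δ * ‖(z : EnergySpace V X U)‖ ^ 2

/-- The extended value `D*u` is unique. -/
theorem HasDualValue.unique [CompleteSpace U] {C : U →ₗ.[ℂ] U} (hC : IsSkewAdjointOp C)
    {Dst : C.domain →ₗ[ℂ] W} {u : U} {y y' : W}
    (h : HasDualValue C Dst u y) (h' : HasDualValue C Dst u y') : y = y' := by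
  obtain ⟨v, hv, ht⟩ := h
  obtain ⟨v', hv', ht'⟩ := h'
  have skew : ∀ p q : C.domain, inner ℂ (C p) (q : U) = -inner ℂ (p : U) (C q) := by
    intro p q
    have hp : (p : U) ∈ C.adjoint.domain := by rw [hC.2]; exact p.2
    have h1 := C.adjoint_isFormalAdjoint hC.1 ⟨p, hp⟩ q
    have h2 : C.adjoint ⟨p, hp⟩ = -C p :=
      @(LinearPMap.ext_iff.1 hC.2).2 p hp p.2
    rw [h2, inner_neg_left] at h1
    rw [← h1, neg_neg]
  refine tendsto_nhds_unique (ht.congr' ?_) ht'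
  filter_upwards [self_mem_nhdsWithin] with ε hε
  obtain ⟨k, e⟩ := hv ε hε
  obtain ⟨k', e'⟩ := hv' ε hε
  congr 1
  have key : ∀ (p : C.domain) (hp : C p ∈ C.domain),
      (p : U) - ((ε : ℂ) ^ 2) • C ⟨C p, hp⟩ = 0 → p = 0 := by
    intro p hp h0
    have h1 : inner ℂ (p : U) ((p : U) - ((ε : ℂ) ^ 2) • C ⟨C p, hp⟩) = 0 := by
      rw [h0, inner_zero_right]
    have h2 := skew p ⟨C p, hp⟩
    rw [inner_sub_right, inner_smul_right, ← neg_eq_iff_eq_neg.2 h2,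
      inner_self_eq_norm_sq_to_K, inner_self_eq_norm_sq_to_K] at h1
    have h3 : ‖(p : U)‖ ^ 2 + ε ^ 2 * ‖C p‖ ^ 2 = 0 := by
      have : ((‖(p : U)‖ ^ 2 + ε ^ 2 * ‖C p‖ ^ 2 : ℝ) : ℂ) = 0 := by
        push_cast
        linear_combination h1
      exact_mod_cast this
    have h4 : ‖(p : U)‖ ^ 2 = 0 := by nlinarith [sq_nonneg ‖(p : U)‖, sq_nonneg (ε * ‖C p‖)]
    have h5 : (p : U) = 0 := by simpa using h4
    exact Subtype.ext h5
  have hk : C (v ε - v' ε) ∈ C.domain := by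
    rw [LinearPMap.map_sub]
    exact C.domain.sub_mem k k'
  refine sub_eq_zero.1 (key (v ε - v' ε) hk ?_)
  have hs : (⟨C (v ε - v' ε), hk⟩ : C.domain) = ⟨C (v ε), k⟩ - ⟨C (v' ε), k'⟩ := by
    ext
    simp [LinearPMap.map_sub]
  rw [hs, LinearPMap.map_sub, smul_sub]
  have := e.trans e'.symm
  push_cast
  rw [sub_sub_sub_comm, sub_eq_zero.2 this]

end System

end

/-! ### Dissipative operators -/

section Dissipative

variable {E : Type*} [NormedAddCommGroup E] [InnerProductSpace ℂ E] {T : E →ₗ.[ℂ] E}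

/-! Both statements are equivalent to the a priori bound `‖z‖ ≤ K ‖(iw - 𝒜_d) z‖`, uniform in real
`w`.

For stability this is the Gearhart–Prüss theorem for contractions. The damped generator is
m-dissipative (`IsMDissipativeOp.systemOp`). Given the bound, a trajectory is cut off in time and
Plancherel's theorem estimates it in `L²` by its commutator with the cutoff; since norms decrease
along trajectories, this gives decay (`IsMDissipativeOp.isExponentiallyStable`). Conversely, a
trajectory starting at `x` stays within `exp t * ‖(iw - T) x‖` of `exp(iwt) x`, so its decay forces
the bound. Yosida approximation supplies the trajectories.

For the Hautus estimate, write the damped operator as the undamped one with input `-D*u` in the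
third component. On a line `Re l = β > 0`, let `p = (l - 𝒜_c)⁻¹(0, 0, D w)`, whose output `D*p` is
`G l w` with `G` bounded. Adding or subtracting such a `p` with `l = β + iw` passes between the
domains of the two generators and costs only terms in `β p`. These are controlled by the energy
identity `Re ⟨z, f⟩ = Re ⟨D*z, w⟩` (`IsControlledRelation.re_inner_eq`). To go from damped to
undamped, the input is `D*u` itself; in the other direction it is `(1 + G l)⁻¹ D*u`, where the
inverse exists because the same identity makes `G l` accretive.

The boundedness of `D` and hypothesis (H) enter only through the existence of this `G`. -/

theorem IsMDissipativeOp.re_inner_nonpos (hT : IsMDissipativeOp T) {u f : E}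
    (h : (u, f) ∈ T.graph) : (inner ℂ u f).re ≤ 0 := by
  obtain ⟨y, rfl, rfl⟩ := (T.mem_graph_iff).1 h
  exact hT.1 y

/-- Take the real part of `⟨u, l u - f⟩` and apply Cauchy–Schwarz. -/
theorem IsMDissipativeOp.re_mul_norm_le (hT : IsMDissipativeOp T) {u f : E}
    (h : (u, f) ∈ T.graph) (l : ℂ) : l.re * ‖u‖ ≤ ‖l • u - f‖ := by
  have h1 := hT.re_inner_nonpos h
  have h2 : (inner ℂ u (l • u - f)).re ≤ ‖u‖ * ‖l • u - f‖ :=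
    (Complex.re_le_norm _).trans (norm_inner_le_norm _ _)
  have h3 : (inner ℂ u (l • u - f)).re = l.re * ‖u‖ ^ 2 - (inner ℂ u f).re := by
    rw [inner_sub_right, inner_smul_right, inner_self_eq_norm_sq_to_K, Complex.sub_re]
    congr 1
    have : ((‖u‖ : ℂ) ^ 2) = ((‖u‖ ^ 2 : ℝ) : ℂ) := by push_cast; rfl
    rw [show ((RCLike.ofReal ‖u‖ : ℂ) ^ 2) = ((‖u‖ ^ 2 : ℝ) : ℂ) from this, Complex.re_mul_ofReal]
  rcases (norm_nonneg u).eq_or_lt with h0 | h0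
  · rw [← h0]; simp
  · nlinarith

/-- The dissipative lower bound makes preimages unique, hence linear in `f` and bounded.
Surjectivity is assumed at the single point `l`, so that the result can serve in the continuation
argument that spreads surjectivity. -/
theorem IsMDissipativeOp.exists_resolvent_of_surjective (hT : IsMDissipativeOp T) {l : ℂ}
    (hl : 0 < l.re) (hs : ∀ f : E, ∃ u g, (u, g) ∈ T.graph ∧ l • u - g = f) :
    ∃ R : E →L[ℂ] E, (∀ f, (R f, l • R f - f) ∈ T.graph) ∧
      (∀ u g, (u, g) ∈ T.graph → R (l • u - g) = u) ∧ ∀ f, l.re * ‖R f‖ ≤ ‖f‖ := by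
  have huniq : ∀ u g u' g' : E, (u, g) ∈ T.graph → (u', g') ∈ T.graph →
      l • u - g = l • u' - g' → u = u' := by
    intro u g u' g' h h' e
    have h1 := hT.re_mul_norm_le (T.graph.sub_mem h h') l
    have e2 : l • (u - u') - (g - g') = 0 := by
      rw [smul_sub, sub_sub_sub_comm, e, sub_self]
    simp only [e2, norm_zero] at h1
    have : ‖u - u'‖ = 0 := by nlinarith [norm_nonneg (u - u')]
    exact sub_eq_zero.1 (norm_eq_zero.1 this)
  choose r g hr hg using hs
  let L : E →ₗ[ℂ] E :=
    { toFun := r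
      map_add' := fun x y => by
        refine huniq _ _ _ _ (hr _) (T.graph.add_mem (hr x) (hr y)) ?_
        rw [hg, smul_add, add_sub_add_comm, hg, hg]
      map_smul' := fun c x => by
        refine huniq _ _ _ _ (hr _) (T.graph.smul_mem c (hr x)) ?_
        rw [hg, RingHom.id_apply, smul_comm, ← smul_sub, hg] }
  have hL : ∀ f, l.re * ‖L f‖ ≤ ‖f‖ := fun f => by
    have := hT.re_mul_norm_le (hr f) l
    rwa [hg] at this
  refine ⟨L.mkContinuous (l.re)⁻¹ fun f => ?_, fun f => ?_, fun u k h => ?_, hL⟩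
  · rw [← div_eq_inv_mul, le_div_iff₀ hl, mul_comm]
    exact hL f
  · have : l • r f - f = g f := by
      have := hg f
      rw [sub_eq_iff_eq_add] at this ⊢
      rw [this, add_comm]
    change (r f, l • r f - f) ∈ T.graph
    rw [this]
    exact hr f
  · exact huniq _ _ _ _ (hr _) h (hg _)

theorem ContinuousLinearMap.exists_add_apply_eq [CompleteSpace E] (P : E →L[ℂ] E) (hP : ‖P‖ < 1)
    (f : E) : ∃ g, g + P g = f := by
  obtain ⟨u, hu⟩ := isUnit_one_sub_of_norm_lt_one (x := -P) (by rwa [norm_neg])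
  refine ⟨(↑u⁻¹ : E →L[ℂ] E) f, ?_⟩
  have h : ((u : E →L[ℂ] E) * ↑u⁻¹) f = f := by rw [Units.mul_inv]; rfl
  rw [hu] at h
  simpa using h

variable [CompleteSpace E]

/-- Neumann series: `(m - T) R = 1 + (m - l) R` with `‖R‖ ≤ 1 / Re l`. -/
theorem IsMDissipativeOp.surjective_of_near (hT : IsMDissipativeOp T) {l m : ℂ}
    (hs : ∀ f : E, ∃ u g, (u, g) ∈ T.graph ∧ l • u - g = f) (hm : ‖m - l‖ < l.re) (f : E) :
    ∃ u g, (u, g) ∈ T.graph ∧ m • u - g = f := by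
  have hl : 0 < l.re := (norm_nonneg _).trans_lt hm
  obtain ⟨R, h1, -, h3⟩ := hT.exists_resolvent_of_surjective hl hs
  have hR : ‖R‖ ≤ l.re⁻¹ := R.opNorm_le_bound (inv_nonneg.2 hl.le) fun f => by
    rw [← div_eq_inv_mul, le_div_iff₀ hl, mul_comm]
    exact h3 f
  obtain ⟨g, hg⟩ := ContinuousLinearMap.exists_add_apply_eq ((m - l) • R) (by
    rw [norm_smul]
    calc ‖m - l‖ * ‖R‖ ≤ ‖m - l‖ * l.re⁻¹ := by gcongr
      _ < 1 := by rwa [← div_eq_mul_inv, div_lt_one hl]) f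
  refine ⟨R g, l • R g - g, h1 g, ?_⟩
  rw [← hg]
  rw [show ((m - l) • R) g = (m - l) • R g from rfl, sub_smul]
  abel

theorem IsMDissipativeOp.surjective (hT : IsMDissipativeOp T) {l : ℂ} (hl : 0 < l.re) (f : E) :
    ∃ u g, (u, g) ∈ T.graph ∧ l • u - g = f := by
  obtain ⟨μ, hμ, hs⟩ := hT.2
  -- Surjectivity at `a > 0` spreads to the disc of radius `a` about `a`, which contains `3a/2`.
  -- Iterating reaches arbitrarily large real points.
  have h0 : ∀ n : ℕ, ∀ f : E, ∃ u g, (u, g) ∈ T.graph ∧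
      (((3 / 2 : ℝ) ^ n * μ : ℝ) : ℂ) • u - g = f := by
    intro n
    induction n with
    | zero =>
      intro f
      obtain ⟨u, hu⟩ := hs f
      exact ⟨u, T u, T.mem_graph u, by simpa using hu⟩
    | succ n ih =>
      refine hT.surjective_of_near ih ?_
      have hp : 0 < (3 / 2 : ℝ) ^ n * μ := by positivity
      rw [← Complex.ofReal_sub, Complex.norm_real, Complex.ofReal_re, Real.norm_eq_abs, pow_succ,
        abs_lt]
      constructor <;> nlinarith
  -- The discs `|l - a| < a`, that is `|l|² < 2 a Re l`, exhaust the right half-plane as `a` grows.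
  obtain ⟨n, hn⟩ := pow_unbounded_of_one_lt (‖l‖ ^ 2 / (l.re * μ)) (by norm_num : (1 : ℝ) < 3 / 2)
  refine hT.surjective_of_near (h0 n) ?_ f
  set a := (3 / 2 : ℝ) ^ n * μ
  have ha : 0 < a := by positivity
  have h1 : ‖l‖ ^ 2 < a * l.re := by
    rw [div_lt_iff₀ (by positivity)] at hn
    calc ‖l‖ ^ 2 < _ := hn
      _ = a * l.re := by ring
  rw [Complex.ofReal_re]
  refine lt_of_pow_lt_pow_left₀ 2 ha.le ?_
  rw [Complex.sq_norm, Complex.normSq_apply] at h1 ⊢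
  simp only [Complex.sub_re, Complex.sub_im, Complex.ofReal_re, Complex.ofReal_im]
  nlinarith

theorem IsMDissipativeOp.exists_resolvent (hT : IsMDissipativeOp T) {l : ℂ} (hl : 0 < l.re) :
    ∃ R : E →L[ℂ] E, (∀ f, (R f, l • R f - f) ∈ T.graph) ∧
      (∀ u g, (u, g) ∈ T.graph → R (l • u - g) = u) ∧ ∀ f, l.re * ‖R f‖ ≤ ‖f‖ :=
  hT.exists_resolvent_of_surjective hl fun f => hT.surjective hl f

/-- A bounded accretive perturbation of an m-dissipative operator is m-dissipative. -/
theorem IsMDissipativeOp.add_bounded (hT : IsMDissipativeOp T) (P : E →L[ℂ] E)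
    (hP : ∀ u, 0 ≤ (inner ℂ u (P u)).re) : IsMDissipativeOp (-(P : E →ₗ[ℂ] E) +ᵥ T) := by
  -- At `‖P‖ + 1` the resolvent `R` of `T` satisfies `‖P R‖ < 1`, so `1 + P R` is invertible.
  refine ⟨fun u => ?_, ‖P‖ + 1, by positivity, fun f => ?_⟩
  · have h1 := hT.1 u
    have h2 := hP u
    rw [LinearPMap.vadd_apply, inner_add_right]
    simp only [LinearMap.neg_apply, inner_neg_right, Complex.add_re, Complex.neg_re,
      ContinuousLinearMap.coe_coe]
    linarith
  · have hm : 0 < (((‖P‖ + 1 : ℝ) : ℂ)).re := by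
      rw [Complex.ofReal_re]; positivity
    obtain ⟨R, h1, -, h3⟩ := hT.exists_resolvent hm
    rw [Complex.ofReal_re] at h3 hm
    obtain ⟨g, hg⟩ := ContinuousLinearMap.exists_add_apply_eq (P.comp R) (by
      have hR : ‖R‖ ≤ (‖P‖ + 1)⁻¹ := R.opNorm_le_bound (by positivity) fun f => by
        rw [← div_eq_inv_mul, le_div_iff₀ hm, mul_comm]
        exact h3 f
      calc ‖P.comp R‖ ≤ ‖P‖ * ‖R‖ := P.opNorm_comp_le R
        _ ≤ ‖P‖ * (‖P‖ + 1)⁻¹ := by gcongr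
        _ < 1 := by rw [← div_eq_mul_inv, div_lt_one hm]; linarith) f
    obtain ⟨y, hy, hy'⟩ := (T.mem_graph_iff).1 (h1 g)
    refine ⟨y, ?_⟩
    rw [LinearPMap.vadd_apply, hy', hy, ← hg]
    simp only [LinearMap.neg_apply, ContinuousLinearMap.coe_coe, ContinuousLinearMap.comp_apply]
    abel

theorem IsMDissipativeOp.surjective_add_bounded (hT : IsMDissipativeOp T) (P : E →L[ℂ] E)
    (hP : ∀ u, 0 ≤ (inner ℂ u (P u)).re) {l : ℂ} (hl : 0 < l.re) (f : E) :
    ∃ u g, (u, g) ∈ T.graph ∧ l • u + P u - g = f := by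
  obtain ⟨u, g, hg, h⟩ := (hT.add_bounded P hP).surjective hl f
  obtain ⟨y, rfl, rfl⟩ := (LinearPMap.mem_graph_iff _).1 hg
  refine ⟨y, T y, T.mem_graph y, ?_⟩
  rw [← h, LinearPMap.vadd_apply]
  simp only [LinearMap.neg_apply, ContinuousLinearMap.coe_coe]
  abel

/-- `1 + P` is invertible if `P` is bounded and accretive. -/
theorem ContinuousLinearMap.exists_one_add_inverse (P : E →L[ℂ] E)
    (hP : ∀ u, 0 ≤ (inner ℂ u (P u)).re) : ∃ R : E →L[ℂ] E, ∀ f, R f + P (R f) = f := by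
  -- `1 + P` is `1 - T` for the perturbation `T = 0 - P` of the zero operator.
  have h0 : IsMDissipativeOp (0 : E →ₗ.[ℂ] E) :=
    ⟨fun u => by simp, 1, one_pos, fun f => ⟨⟨f, trivial⟩, by simp⟩⟩
  obtain ⟨R, h1, -, -⟩ := (h0.add_bounded P hP).exists_resolvent (l := 1) (by simp)
  refine ⟨R, fun f => ?_⟩
  obtain ⟨y, hy, hy'⟩ := (LinearPMap.mem_graph_iff _).1 (h1 f)
  rw [LinearPMap.vadd_apply, LinearPMap.zero_apply] at hy'
  simp only [LinearMap.neg_apply, ContinuousLinearMap.coe_coe, hy, one_smul, add_zero] at hy'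
  rw [neg_eq_iff_eq_neg.1 hy']
  abel

/-- If `z = u - Tu` is orthogonal to the domain, pairing with `u` gives `‖u‖² = ⟨u, Tu⟩`, and
dissipativity forces `u = 0`. -/
theorem IsMDissipativeOp.dense_domain (hT : IsMDissipativeOp T) : Dense (T.domain : Set E) := by
  rw [Submodule.dense_iff_topologicalClosure_eq_top, Submodule.topologicalClosure_eq_top_iff,
    Submodule.eq_bot_iff]
  intro z hz
  obtain ⟨u, g, hg, h⟩ := hT.surjective (l := 1) (by simp) z
  have h1 : inner ℂ u z = 0 := hz u (LinearPMap.mem_domain_of_mem_graph hg)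
  have h2 := hT.re_inner_nonpos hg
  rw [← h, one_smul, inner_sub_right, sub_eq_zero] at h1
  rw [← h1, inner_self_eq_norm_sq_to_K] at h2
  have h3 : ‖u‖ ^ 2 ≤ 0 := by exact_mod_cast h2
  have hu : u = 0 := by
    rw [← norm_eq_zero]
    nlinarith [norm_nonneg u]
  subst hu
  rw [← h, T.graph_fst_eq_zero_snd hg rfl]
  simp

/-- The resolvents `n (n - T)⁻¹`: contractions into the domain that tend strongly to `1`. -/
theorem IsMDissipativeOp.exists_approximation (hT : IsMDissipativeOp T) :
    ∃ J : ℕ → E →L[ℂ] E, (∀ (n : ℕ) f, (J n f, ((n : ℂ) + 1) • (J n f - f)) ∈ T.graph) ∧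
      (∀ (n : ℕ) u g, (u, g) ∈ T.graph → ((n : ℂ) + 1) • (J n u - u) = J n g) ∧
      (∀ n f, ‖J n f‖ ≤ ‖f‖) ∧ ∀ f, Tendsto (fun n => J n f) atTop (𝓝 f) := by
  have hre : ∀ n : ℕ, ((n : ℂ) + 1).re = (n : ℝ) + 1 := fun n => by simp
  have hpos : ∀ n : ℕ, 0 < ((n : ℂ) + 1).re := fun n => by rw [hre]; positivity
  choose R h1 h2 h3 using fun n : ℕ => hT.exists_resolvent (hpos n)
  have hJ : ∀ (n : ℕ) f, ‖(((n : ℂ) + 1) • R n) f‖ ≤ ‖f‖ := fun n f => by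
    have := h3 n f
    have e : ‖(n : ℂ) + 1‖ = (n : ℝ) + 1 := by
      have : ((n : ℂ) + 1) = (((n : ℝ) + 1 : ℝ) : ℂ) := by push_cast; rfl
      rw [this, Complex.norm_real, Real.norm_of_nonneg (by positivity)]
    rw [hre] at this
    change ‖((n : ℂ) + 1) • R n f‖ ≤ _
    rwa [norm_smul, e]
  have hb : ∀ (n : ℕ) u g, (u, g) ∈ T.graph →
      ((n : ℂ) + 1) • ((((n : ℂ) + 1) • R n) u - u) = (((n : ℂ) + 1) • R n) g := by
    intro n u g h
    have := h2 n u g h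
    change ((n : ℂ) + 1) • (((n : ℂ) + 1) • R n u - u) = ((n : ℂ) + 1) • R n g
    congr 1
    rw [map_sub, map_smul] at this
    nth_rewrite 2 [← this]
    abel
  refine ⟨fun n => ((n : ℂ) + 1) • R n, fun n f => ?_, hb, hJ, fun f => ?_⟩
  · exact T.graph.smul_mem ((n : ℂ) + 1) (h1 n f)
  · rw [Metric.tendsto_atTop]
    intro ε hε
    -- On the domain `‖J n u - u‖ ≤ ‖T u‖ / (n + 1)`; density and contractivity give the rest.
    obtain ⟨u, hu, hfu⟩ := Metric.dense_iff.1 hT.dense_domain f (ε / 4) (by positivity)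
    obtain ⟨g, hg⟩ := LinearPMap.mem_domain_iff.1 hfu
    rw [Metric.mem_ball, dist_eq_norm] at hu
    obtain ⟨N, hN⟩ := exists_nat_gt (‖g‖ / (ε / 4))
    refine ⟨N, fun n hn => ?_⟩
    have hn' : (N : ℝ) ≤ n := by exact_mod_cast hn
    have k1 : ((n : ℝ) + 1) * ‖(((n : ℂ) + 1) • R n) u - u‖ ≤ ‖g‖ := by
      have e : ‖(n : ℂ) + 1‖ = (n : ℝ) + 1 := by
        have : ((n : ℂ) + 1) = (((n : ℝ) + 1 : ℝ) : ℂ) := by push_cast; rfl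
        rw [this, Complex.norm_real, Real.norm_of_nonneg (by positivity)]
      rw [← e, ← norm_smul, hb n u g hg]
      exact hJ n g
    have k2 : ‖(((n : ℂ) + 1) • R n) u - u‖ < ε / 4 := by
      rw [div_lt_iff₀ (by positivity)] at hN
      by_contra! hc
      nlinarith
    have k3 := hJ n (u - f)
    rw [map_sub] at k3
    rw [dist_eq_norm]
    set a := (((n : ℂ) + 1) • R n) u
    set b := (((n : ℂ) + 1) • R n) f
    calc ‖b - f‖ = ‖-(a - b) + (a - u) + (u - f)‖ := by congr 1; abel
      _ ≤ ‖a - b‖ + ‖a - u‖ + ‖u - f‖ := by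
        refine (norm_add_le _ _).trans ?_
        gcongr
        refine (norm_add_le _ _).trans ?_
        rw [norm_neg]
      _ < ε := by linarith

end Dissipative

/-! ### Plancherel's theorem and the Gearhart–Prüss theorem for contractions -/

section Gearhart

open MeasureTheory FourierTransform

variable {E : Type*} [NormedAddCommGroup E] [InnerProductSpace ℂ E] {T : E →ₗ.[ℂ] E}

theorem IsClassicalSolution.comp_add {z : ℝ → E} (hz : IsClassicalSolution T z) {s : ℝ}
    (hs : 0 ≤ s) : IsClassicalSolution T fun t => z (t + s) := by
  obtain ⟨z', hc, h⟩ := hz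
  have hmap : Set.MapsTo (fun t : ℝ => t + s) (Set.Ici 0) (Set.Ici 0) :=
    fun t ht => add_nonneg ht hs
  refine ⟨fun t => z' (t + s), hc.comp (by fun_prop) hmap, fun t ht => ?_⟩
  obtain ⟨h1, h2⟩ := h (t + s) (add_nonneg ht hs)
  refine ⟨h1, ?_⟩
  have h3 : HasDerivWithinAt (fun t : ℝ => t + s) 1 (Set.Ici 0) t :=
    ((hasDerivAt_id t).add_const s).hasDerivWithinAt
  have h4 := h2.scomp t h3 hmap
  rw [one_smul] at h4
  exact h4

theorem hasDerivWithinAt_norm_sq_complex {z : ℝ → E} {d : E} {s : Set ℝ} {t : ℝ}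
    (h : HasDerivWithinAt z d s t) :
    HasDerivWithinAt (fun t => ‖z t‖ ^ 2) (2 * (inner ℂ (z t) d).re) s t := by
  let _ : InnerProductSpace ℝ E := InnerProductSpace.rclikeToReal ℂ E
  have := HasDerivWithinAt.norm_sq h
  simpa [real_inner_eq_re_inner ℂ] using this

theorem IsMDissipativeOp.norm_antitoneOn (hT : IsMDissipativeOp T) {z : ℝ → E}
    (hz : IsClassicalSolution T z) : AntitoneOn (fun t => ‖z t‖) (Set.Ici 0) := by
  obtain ⟨z', -, h⟩ := hz
  have h1 : AntitoneOn (fun t => ‖z t‖ ^ 2) (Set.Ici 0) := by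
    refine antitoneOn_of_hasDerivWithinAt_nonpos (convex_Ici 0)
      (f' := fun t => 2 * (inner ℂ (z t) (z' t)).re)
      (fun t ht => (hasDerivWithinAt_norm_sq_complex (h t ht).2).continuousWithinAt)
      (fun t ht => ?_) fun t ht => ?_
    · exact (hasDerivWithinAt_norm_sq_complex (h t (interior_subset ht)).2).mono interior_subset
    · have := hT.re_inner_nonpos (h t (interior_subset ht)).1
      linarith
  intro a ha b hb hab
  exact (sq_le_sq₀ (norm_nonneg _) (norm_nonneg _)).1 (h1 ha hb hab)

variable [CompleteSpace E]

/-- The `L²` Fourier transform of an integrable `L²` function is its Fourier integral. -/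
theorem coeFn_fourier_toLp_ae_eq {f : ℝ → E} (hf : Integrable f) (hf2 : MemLp f 2) :
    (𝓕 (hf2.toLp f) : Lp (α := ℝ) E 2) =ᵐ[volume] 𝓕 f := by
  have hcont : Continuous (𝓕 f) :=
    VectorFourier.fourierIntegral_continuous Real.continuous_fourierChar
      (by fun_prop : Continuous fun p : ℝ × ℝ => (innerₗ ℝ) p.1 p.2) hf
  -- Both functions represent the same tempered distribution: each is paired with a test function,
  -- and the Fourier transform is moved onto it.
  refine ae_eq_of_integral_contDiff_smul_eq
    ((Lp.memLp _).locallyIntegrable (by norm_num)) hcont.locallyIntegrable fun g hg hc => ?_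
  have hg₁ : HasCompactSupport (Complex.ofRealCLM ∘ g) := hc.comp_left rfl
  have hg₂ : ContDiff ℝ (↑(⊤ : ℕ∞)) (Complex.ofRealCLM ∘ g) := by fun_prop
  let φ := hg₁.toSchwartzMap hg₂
  have h1 := congrArg (fun S => S φ) (Lp.fourier_toTemperedDistribution_eq (hf2.toLp f))
  simp only [TemperedDistribution.fourier_apply, Lp.toTemperedDistribution_apply] at h1
  have h2 : ∫ x, (𝓕 φ) x • (hf2.toLp f) x = ∫ x, (𝓕 (φ : ℝ → ℂ)) x • f x := by
    refine integral_congr_ae ?_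
    filter_upwards [hf2.coeFn_toLp] with x hx
    rw [hx]
    rfl
  have h3 : ∫ x, (𝓕 (φ : ℝ → ℂ)) x • f x = ∫ x, φ x • (𝓕 f) x := by
    have := VectorFourier.integral_fourierIntegral_smul_eq_flip (L := innerₗ ℝ) (μ := volume)
      (ν := volume) Real.continuous_fourierChar
      (by fun_prop : Continuous fun p : ℝ × ℝ => (innerₗ ℝ) p.1 p.2) φ.integrable hf
    rwa [flip_innerₗ] at this
  rw [h2, h3] at h1
  exact h1.symm

theorem eLpNorm_fourier_eq {f : ℝ → E} (hf : Integrable f) (hf2 : MemLp f 2) :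
    eLpNorm (𝓕 f) 2 = eLpNorm f 2 := by
  rw [← eLpNorm_congr_ae (coeFn_fourier_toLp_ae_eq hf hf2),
    ← eLpNorm_congr_ae hf2.coeFn_toLp]
  have := Lp.norm_fourier_eq (hf2.toLp f)
  rw [Lp.norm_def, Lp.norm_def,
    ENNReal.toReal_eq_toReal_iff' (Lp.eLpNorm_ne_top _) (Lp.eLpNorm_ne_top _)] at this
  exact this

/-- If `v' = T v + g` for compactly supported `v` and `g`, then a bound for the resolvent on the
imaginary axis bounds `v` by `g` in `L²`. -/
theorem IsMDissipativeOp.eLpNorm_le (hT : IsMDissipativeOp T) {M : ℝ}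
    (hM : ∀ (w : ℝ) (z f : E), (z, f) ∈ T.graph → ‖z‖ ≤ M * ‖(Complex.I * (w : ℂ)) • z - f‖)
    {v v' g : ℝ → E} (hv : ∀ t, HasDerivAt v (v' t) t) (hv' : Continuous v') (hg : Continuous g)
    (hcv : HasCompactSupport v) (hcv' : HasCompactSupport v') (hcg : HasCompactSupport g)
    (hG : ∀ t, (v t, v' t - g t) ∈ T.graph) :
    eLpNorm v 2 ≤ ENNReal.ofReal M * eLpNorm g 2 := by
  have hvc : Continuous v := continuous_iff_continuousAt.2 fun t => (hv t).continuousAt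
  have iv := hvc.integrable_of_hasCompactSupport (μ := volume) hcv
  have iv' := hv'.integrable_of_hasCompactSupport (μ := volume) hcv'
  have ig := hg.integrable_of_hasCompactSupport (μ := volume) hcg
  have hd : deriv v = v' := funext fun t => (hv t).deriv
  have hF := Real.fourier_deriv iv (fun t => (hv t).differentiableAt) (by rwa [hd])
  rw [hd] at hF
  obtain ⟨R, h1, h2, -⟩ := hT.exists_resolvent (l := 1) (by simp)
  -- The transform of `v` solves the resolvent equation. To avoid integrating the unbounded `T`, the
  -- equation is written `v = (1 - T)⁻¹ (v - v' + g)`, and the bounded operator commutes with the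
  -- integral. Surjectivity of `iw - T` is not needed.
  have key : ∀ ξ : ℝ, (𝓕 v ξ, (Complex.I * ((2 * Real.pi * ξ : ℝ) : ℂ)) • 𝓕 v ξ - 𝓕 g ξ) ∈
      T.graph := by
    intro ξ
    have e1 : v = fun t => R (v t - v' t + g t) := by
      funext t
      have := h2 _ _ (hG t)
      rw [one_smul] at this
      rw [show v t - v' t + g t = v t - (v' t - g t) by abel, this]
    have e2 : 𝓕 v ξ = R (𝓕 v ξ - 𝓕 v' ξ + 𝓕 g ξ) := by
      conv_lhs => rw [e1]
      have i1 : ∀ {u : ℝ → E}, Integrable u →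
          Integrable fun t => Real.fourierChar (-(t * ξ)) • u t := fun hu => by
        have := (Real.fourierIntegral_convergent_iff (f := _) ξ).2 hu
        simpa [mul_comm] using this
      simp only [Real.fourier_real_eq]
      have e4 := R.integral_comp_comm (((i1 iv).sub (i1 iv')).add (i1 ig))
      simp only [Pi.add_apply, Pi.sub_apply] at e4
      have e5 := integral_add ((i1 iv).sub (i1 iv')) (i1 ig)
      simp only [Pi.sub_apply] at e5
      rw [← integral_sub (i1 iv) (i1 iv'), ← e5, ← e4]
      congr 1
      funext t
      rw [← smul_sub, ← smul_add, Circle.smul_def, Circle.smul_def, map_smul]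
    have e3 := h1 (𝓕 v ξ - 𝓕 v' ξ + 𝓕 g ξ)
    rw [← e2, one_smul] at e3
    convert e3 using 2
    rw [congrFun hF ξ]
    push_cast
    rw [show (Complex.I * (2 * (Real.pi : ℂ) * ξ)) = 2 * Real.pi * Complex.I * ξ by ring]
    abel
  rw [← eLpNorm_fourier_eq iv (hvc.memLp_of_hasCompactSupport hcv),
    ← eLpNorm_fourier_eq ig (hg.memLp_of_hasCompactSupport hcg)]
  refine eLpNorm_le_mul_eLpNorm_of_ae_le_mul (Eventually.of_forall fun ξ => ?_) 2
  have := hM (2 * Real.pi * ξ) _ _ (key ξ)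
  simpa using this

/-- Quantitative decay over a time `3τ` for a contraction semigroup with bounded resolvent on the
imaginary axis. -/
theorem IsMDissipativeOp.exists_norm_le_div (hT : IsMDissipativeOp T) {M : ℝ} (hM0 : 0 ≤ M)
    (hM : ∀ (w : ℝ) (z f : E), (z, f) ∈ T.graph → ‖z‖ ≤ M * ‖(Complex.I * (w : ℂ)) • z - f‖) :
    ∃ K : ℝ, 0 ≤ K ∧ ∀ τ : ℝ, 0 < τ → ∀ z : ℝ → E, IsClassicalSolution T z →
      ‖z (3 * τ)‖ ≤ K / τ * ‖z 0‖ := by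
  -- The cutoff is supported in `[1, 3]` and equals `1` on `[3/2, 5/2]`. It is rescaled by `τ`
  -- below; vanishing near `0` removes the initial value from the equation.
  let ψ : ContDiffBump (2 : ℝ) := ⟨1 / 2, 1, by norm_num, by norm_num⟩
  have hψ : ContDiff ℝ 1 ψ := ψ.contDiff
  have hψd : ∀ t, HasDerivAt ψ (deriv ψ t) t := fun t =>
    (hψ.differentiable (by norm_num) t).hasDerivAt
  have hψc : Continuous (deriv ψ) := hψ.continuous_deriv (by norm_num)
  have hψs : HasCompactSupport (deriv ψ) := ψ.hasCompactSupport.deriv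
  obtain ⟨K, hK⟩ := hψc.bounded_above_of_compact_support hψs
  have hK0 : 0 ≤ K := (norm_nonneg _).trans (hK 0)
  have hψ0 : ∀ t, t < 1 ∨ 3 < t → (ψ t = 0 ∧ deriv ψ t = 0) := by
    intro t ht
    have hz : ∀ s, s ≤ 1 ∨ 3 ≤ s → ψ s = 0 := by
      intro s hs
      refine ψ.zero_of_le_dist ?_
      change (1 : ℝ) ≤ dist s 2
      rw [Real.dist_eq]
      rcases hs with hs | hs
      · rw [abs_of_nonpos (by linarith)]; linarith
      · rw [abs_of_nonneg (by linarith)]; linarith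
    have he : ψ =ᶠ[𝓝 t] fun _ => 0 := by
      rcases ht with ht | ht
      · filter_upwards [Iio_mem_nhds ht] with s hs using hz s (Or.inl (le_of_lt hs))
      · filter_upwards [Ioi_mem_nhds ht] with s hs using hz s (Or.inr (le_of_lt hs))
    exact ⟨he.eq_of_nhds, by rw [he.deriv_eq]; simp⟩
  have hψ1 : ∀ t ∈ Set.Icc (3 / 2 : ℝ) (5 / 2), ψ t = 1 := by
    intro t ht
    refine ψ.one_of_mem_closedBall ?_
    rw [Metric.mem_closedBall, Real.dist_eq, abs_le]
    change -(1 / 2 : ℝ) ≤ _ ∧ _ ≤ (1 / 2 : ℝ)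
    constructor <;> linarith [ht.1, ht.2]
  refine ⟨M * K * √3, by positivity, fun τ hτ z hz => ?_⟩
  obtain ⟨z', hz'c, h⟩ := id hz
  have hτi : 0 < τ⁻¹ := inv_pos.2 hτ
  let Z : ℝ → E := fun t => z (max t 0)
  let Z' : ℝ → E := fun t => z' (max t 0)
  have hmax : ∀ t : ℝ, max t 0 ∈ Set.Ici (0 : ℝ) := fun t => le_max_right t 0
  have hzc : ContinuousOn z (Set.Ici 0) := fun t ht => (h t ht).2.continuousWithinAt
  have hZ : Continuous Z := hzc.comp_continuous (by fun_prop) hmax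
  have hZ' : Continuous Z' := hz'c.comp_continuous (by fun_prop) hmax
  let χ : ℝ → ℝ := fun t => ψ (τ⁻¹ * t)
  let χ' : ℝ → ℝ := fun t => τ⁻¹ * deriv ψ (τ⁻¹ * t)
  have hχ : ∀ t, HasDerivAt χ (χ' t) t := fun t => by
    have h1 : HasDerivAt (fun t : ℝ => τ⁻¹ * t) τ⁻¹ t := by
      simpa using (hasDerivAt_id t).const_mul τ⁻¹
    have := (hψd (τ⁻¹ * t)).comp t h1
    rwa [mul_comm] at this
  have hχc : Continuous χ := continuous_iff_continuousAt.2 fun t => (hχ t).continuousAt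
  have hχ'c : Continuous χ' := by fun_prop
  have hχ0 : ∀ t, t ∉ Set.Icc τ (3 * τ) → χ t = 0 ∧ χ' t = 0 := by
    intro t ht
    rw [Set.mem_Icc, not_and_or, not_le, not_le] at ht
    have : τ⁻¹ * t < 1 ∨ 3 < τ⁻¹ * t := by
      rw [inv_mul_lt_iff₀ hτ, lt_inv_mul_iff₀ hτ]
      rcases ht with ht | ht
      · left; linarith
      · right; linarith
    obtain ⟨h1, h2⟩ := hψ0 _ this
    exact ⟨h1, by simp only [χ', h2, mul_zero]⟩
  have hsupp : ∀ u : ℝ → E, (∀ t, t ∉ Set.Icc τ (3 * τ) → u t = 0) → HasCompactSupport u :=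
    fun u hu => HasCompactSupport.intro isCompact_Icc hu
  -- Since `z' = T z`, the function `v = χ z` satisfies `v' = T v + χ' z`, with `χ'` of size `1/τ`.
  let v : ℝ → E := fun t => χ t • Z t
  let g : ℝ → E := fun t => χ' t • Z t
  let v' : ℝ → E := fun t => χ t • Z' t + χ' t • Z t
  have hv : ∀ t, HasDerivAt v (v' t) t := by
    intro t
    rcases lt_or_ge 0 t with ht | ht
    · have h1 : HasDerivAt Z (Z' t) t := by
        have h2 : HasDerivAt z (z' t) t := (h t ht.le).2.hasDerivAt (Ici_mem_nhds ht)
        have h3 : Z =ᶠ[𝓝 t] z := by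
          filter_upwards [Ioi_mem_nhds ht] with s hs
          simp only [Z, max_eq_left (le_of_lt (Set.mem_Ioi.1 hs))]
        simp only [Z', max_eq_left ht.le]
        exact h2.congr_of_eventuallyEq h3
      exact (hχ t).smul h1
    · have h1 : v =ᶠ[𝓝 t] fun _ => 0 := by
        filter_upwards [Iio_mem_nhds (ht.trans_lt hτ)] with s hs
        simp only [v, (hχ0 s fun hh => absurd hh.1 (not_le.2 hs)).1, zero_smul]
      obtain ⟨h2, h3⟩ := hχ0 t fun hh => absurd hh.1 (not_le.2 (ht.trans_lt hτ))
      simp only [v', h2, h3, zero_smul, add_zero]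
      exact (hasDerivAt_const t (0 : E)).congr_of_eventuallyEq h1
  have hle := hT.eLpNorm_le hM (v := v) (v' := v') (g := g) hv (by fun_prop) (by fun_prop)
    (hsupp _ fun t ht => by simp only [v, (hχ0 t ht).1, zero_smul])
    (hsupp _ fun t ht => by simp only [v', (hχ0 t ht).1, (hχ0 t ht).2, zero_smul, add_zero])
    (hsupp _ fun t ht => by simp only [g, (hχ0 t ht).2, zero_smul]) (fun t => by
      have h1 := T.graph.smul_mem (χ t : ℂ) (h _ (hmax t)).1
      have h2 : v' t - g t = χ t • Z' t := by simp only [v', g, add_sub_cancel_right]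
      rw [h2]
      exact h1)
  have hanti := hT.norm_antitoneOn hz
  -- By monotonicity of the norm, `v` is at least `‖z (3τ)‖` on an interval of length `τ`, while `g`
  -- is at most `K ‖z 0‖ / τ` on one of length `3τ`. Comparing `L²` norms gives the factor `M K √3 /
  -- τ`.
  have lower : eLpNorm ((Set.Icc (τ * (3 / 2)) (τ * (5 / 2))).indicator fun _ => z (3 * τ)) 2
      volume ≤ eLpNorm v 2 := by
    refine eLpNorm_mono fun t => ?_
    by_cases ht : t ∈ Set.Icc (τ * (3 / 2)) (τ * (5 / 2))
    · rw [Set.indicator_of_mem ht]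
      have h1 : χ t = 1 := hψ1 _ ⟨by rw [le_inv_mul_iff₀ hτ]; exact ht.1,
        by rw [inv_mul_le_iff₀ hτ]; exact ht.2⟩
      have h0 : 0 ≤ t := le_trans (by positivity) ht.1
      simp only [v, h1, one_smul, Z, max_eq_left h0]
      exact hanti h0 (by simp only [Set.mem_Ici]; positivity) (by linarith [ht.2])
    · rw [Set.indicator_of_notMem ht, norm_zero]
      exact norm_nonneg _
  have upper : eLpNorm g 2 ≤
      eLpNorm ((Set.Icc 0 (3 * τ)).indicator fun _ => K * τ⁻¹ * ‖z 0‖) 2 volume := by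
    refine eLpNorm_mono_real fun t => ?_
    by_cases ht : t ∈ Set.Icc 0 (3 * τ)
    · rw [Set.indicator_of_mem ht]
      simp only [g, norm_smul, χ', norm_mul, Real.norm_of_nonneg hτi.le]
      have h1 := hK (τ⁻¹ * t)
      have h2 : ‖Z t‖ ≤ ‖z 0‖ := hanti Set.self_mem_Ici (hmax t) (hmax t)
      rw [mul_comm K]
      gcongr
    · rw [Set.indicator_of_notMem ht]
      have h1 : t ∉ Set.Icc τ (3 * τ) := fun hh => ht ⟨hτ.le.trans hh.1, hh.2⟩
      simp [g, (hχ0 t h1).2]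
  have fin := lower.trans (hle.trans (mul_le_mul_right upper _))
  have hlen : τ * (5 / 2) - τ * (3 / 2) = τ := by ring
  rw [eLpNorm_indicator_const measurableSet_Icc (by norm_num) (by norm_num),
    eLpNorm_indicator_const measurableSet_Icc (by norm_num) (by norm_num), Real.volume_Icc,
    Real.volume_Icc, hlen, sub_zero, ENNReal.toReal_ofNat,
    ENNReal.ofReal_rpow_of_nonneg hτ.le (by norm_num),
    ENNReal.ofReal_rpow_of_nonneg (by positivity) (by norm_num),
    ← ofReal_norm, ← ofReal_norm, ← ENNReal.ofReal_mul (by positivity),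
    ← ENNReal.ofReal_mul (by positivity), ← ENNReal.ofReal_mul (by positivity),
    ENNReal.ofReal_le_ofReal_iff (by positivity), ← Real.sqrt_eq_rpow, ← Real.sqrt_eq_rpow,
    Real.norm_of_nonneg (by positivity), Real.sqrt_mul (by norm_num)] at fin
  have hs : 0 < √τ := Real.sqrt_pos.2 hτ
  refine le_of_mul_le_mul_right (fin.trans_eq ?_) hs
  field_simp

/-- A contraction semigroup on a Hilbert space whose generator has a resolvent bounded on the
imaginary axis is exponentially stable. -/
theorem IsMDissipativeOp.isExponentiallyStable (hT : IsMDissipativeOp T) {M : ℝ} (hM0 : 0 ≤ M)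
    (hM : ∀ (w : ℝ) (z f : E), (z, f) ∈ T.graph → ‖z‖ ≤ M * ‖(Complex.I * (w : ℂ)) • z - f‖) :
    IsExponentiallyStable T := by
  obtain ⟨K, hK0, hK⟩ := hT.exists_norm_le_div hM0 hM
  -- This makes `K / τ ≤ 1/2`: the norm halves, and the energy is quartered, in each period `3τ`.
  set τ := 2 * K + 1 with hτdef
  have hτ : 0 < τ := by positivity
  have half : ∀ z : ℝ → E, IsClassicalSolution T z → ‖z (3 * τ)‖ ≤ 1 / 2 * ‖z 0‖ := fun z hz => by
    have h1 : K / τ ≤ 1 / 2 := by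
      rw [div_le_iff₀ hτ]
      linarith
    exact (hK τ hτ z hz).trans (by gcongr)
  have iter : ∀ n : ℕ, ∀ z : ℝ → E, IsClassicalSolution T z →
      ‖z (n * (3 * τ))‖ ≤ (1 / 2) ^ n * ‖z 0‖ := by
    intro n
    induction n with
    | zero => intro z _; simp
    | succ n ih =>
      intro z hz
      have h1 := ih _ (hz.comp_add (s := 3 * τ) (by positivity))
      have h2 := half z hz
      simp only [zero_add] at h1
      rw [show ((n + 1 : ℕ) : ℝ) * (3 * τ) = n * (3 * τ) + 3 * τ by push_cast; ring, pow_succ,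
        mul_assoc]
      exact h1.trans (by gcongr)
  -- The constant `4` pays for the incomplete last period.
  refine ⟨4, Real.log 4 / (3 * τ), by norm_num, div_pos (Real.log_pos (by norm_num))
    (by positivity), fun z₀ z hz _ t ht => ?_⟩
  set n := ⌊t / (3 * τ)⌋₊
  have hn1 : n * (3 * τ) ≤ t := by
    rw [← le_div_iff₀ (by positivity)]
    exact Nat.floor_le (by positivity)
  have hn2 : t / (3 * τ) < n + 1 := Nat.lt_floor_add_one _
  have h1 : ‖z t‖ ≤ (1 / 2) ^ n * ‖z 0‖ :=
    (hT.norm_antitoneOn hz (Set.mem_Ici.2 (by positivity)) ht hn1).trans (iter n z hz)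
  have h2 : ‖z t‖ ^ 2 ≤ (1 / 4) ^ n * ‖z 0‖ ^ 2 := by
    calc ‖z t‖ ^ 2 ≤ ((1 / 2) ^ n * ‖z 0‖) ^ 2 := by gcongr
      _ = (1 / 4) ^ n * ‖z 0‖ ^ 2 := by
        rw [mul_pow, ← pow_mul, mul_comm n 2, pow_mul]; norm_num
  have h3 : (1 / 4 : ℝ) ^ n ≤ 4 * Real.exp (-(Real.log 4 / (3 * τ)) * t) := by
    have e1 : (1 / 4 : ℝ) ^ n = Real.exp (-(Real.log 4 * n)) := by
      rw [Real.exp_neg, mul_comm, Real.exp_nat_mul, Real.exp_log (by norm_num), one_div, inv_pow]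
    have e2 : 4 * Real.exp (-(Real.log 4 / (3 * τ)) * t) =
        Real.exp (Real.log 4 + -(Real.log 4 / (3 * τ)) * t) := by
      rw [Real.exp_add, Real.exp_log (by norm_num)]
    rw [e1, e2, Real.exp_le_exp]
    have hl : 0 < Real.log 4 := Real.log_pos (by norm_num)
    have e3 : Real.log 4 / (3 * τ) * t = Real.log 4 * (t / (3 * τ)) := by ring
    have e4 := mul_le_mul_of_nonneg_left hn2.le hl.le
    linarith
  calc 1 / 2 * ‖z t‖ ^ 2 ≤ 1 / 2 * ((1 / 4) ^ n * ‖z 0‖ ^ 2) := by gcongr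
    _ ≤ 1 / 2 * (4 * Real.exp (-(Real.log 4 / (3 * τ)) * t) * ‖z 0‖ ^ 2) := by gcongr
    _ = _ := by ring

end Gearhart

/-! ### Existence of classical solutions -/

section Yosida

variable {E : Type*} [NormedAddCommGroup E] [InnerProductSpace ℂ E] {T : E →ₗ.[ℂ] E}

/-- Growth estimate for solutions of a dissipative equation with a bounded right-hand side. -/
theorem norm_le_exp_mul_of_hasDerivWithinAt {e q r : ℝ → E} {ρ : ℝ}
    (he : ∀ t, 0 ≤ t → HasDerivWithinAt e (q t + r t) (Set.Ici 0) t)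
    (hq : ∀ t, 0 ≤ t → (inner ℂ (e t) (q t)).re ≤ 0) (hr : ∀ t, 0 ≤ t → ‖r t‖ ≤ ρ)
    (h0 : e 0 = 0) {t : ℝ} (ht : 0 ≤ t) : ‖e t‖ ≤ Real.exp t * ρ := by
  have hρ : 0 ≤ ρ := (norm_nonneg _).trans (hr 0 le_rfl)
  have hd : ∀ t, 0 ≤ t → HasDerivWithinAt (fun t => Real.exp (-t) * (‖e t‖ ^ 2 + ρ ^ 2))
      (Real.exp (-t) * -1 * (‖e t‖ ^ 2 + ρ ^ 2) +
        Real.exp (-t) * (2 * (inner ℂ (e t) (q t + r t)).re)) (Set.Ici 0) t := fun t ht =>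
    ((hasDerivAt_neg t).exp.hasDerivWithinAt).mul
      ((hasDerivWithinAt_norm_sq_complex (he t ht)).add_const _)
  -- The inequality `2 ‖e‖ ρ ≤ ‖e‖² + ρ²` lets the weight `exp(-t)` absorb the forcing, and adding
  -- `ρ²` makes the functional monotone.
  have hanti : AntitoneOn (fun t => Real.exp (-t) * (‖e t‖ ^ 2 + ρ ^ 2)) (Set.Ici 0) := by
    refine antitoneOn_of_hasDerivWithinAt_nonpos (convex_Ici 0)
      (fun t ht => (hd t ht).continuousWithinAt)
      (fun t ht => (hd t (interior_subset ht)).mono interior_subset) fun t ht => ?_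
    have ht' : 0 ≤ t := interior_subset ht
    have h1 := hq t ht'
    have h2 : (inner ℂ (e t) (r t)).re ≤ ‖e t‖ * ρ :=
      (Complex.re_le_norm _).trans ((norm_inner_le_norm _ _).trans (by
        gcongr
        exact hr t ht'))
    have h3 : Real.exp (-t) * -1 * (‖e t‖ ^ 2 + ρ ^ 2) +
        Real.exp (-t) * (2 * (inner ℂ (e t) (q t + r t)).re) =
        -(Real.exp (-t) * (‖e t‖ ^ 2 + ρ ^ 2 - 2 * (inner ℂ (e t) (q t)).re -
          2 * (inner ℂ (e t) (r t)).re)) := by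
      rw [inner_add_right, Complex.add_re]
      ring
    rw [h3, neg_nonpos]
    refine mul_nonneg (Real.exp_pos _).le ?_
    nlinarith [sq_nonneg (‖e t‖ - ρ)]
  have h1 := hanti Set.self_mem_Ici ht ht
  simp only [h0, norm_zero, neg_zero, Real.exp_zero, one_mul, Real.exp_neg] at h1
  rw [inv_mul_le_iff₀ (Real.exp_pos t)] at h1
  have h2 : (1 : ℝ) ≤ Real.exp t := Real.one_le_exp ht
  refine (sq_le_sq₀ (norm_nonneg _) (by positivity)).1 ?_
  have h3 : Real.exp t * ρ ^ 2 ≤ Real.exp t * (Real.exp t * ρ ^ 2) := by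
    have : ρ ^ 2 ≤ Real.exp t * ρ ^ 2 := le_mul_of_one_le_left (sq_nonneg _) h2
    gcongr
  nlinarith [sq_nonneg ρ]

variable [CompleteSpace E]

theorem IsMDissipativeOp.isClosed_graph (hT : IsMDissipativeOp T) :
    IsClosed (T.graph : Set (E × E)) := by
  obtain ⟨R, h1, h2, -⟩ := hT.exists_resolvent (l := 1) (by simp)
  have : (T.graph : Set (E × E)) = {p | R (p.1 - p.2) = p.1} := by
    ext ⟨u, g⟩
    simp only [SetLike.mem_coe, Set.mem_ofPred_eq]
    constructor
    · intro h
      simpa using h2 u g h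
    · intro h
      have := h1 (u - g)
      rwa [h, one_smul, sub_sub_cancel] at this
  rw [this]
  exact isClosed_eq (by fun_prop) (by fun_prop)

theorem hasDerivAt_exp_smul_apply (A : E →L[ℂ] E) (x : E) (t : ℝ) :
    HasDerivAt (fun t : ℝ => NormedSpace.exp (t • A) x) (A (NormedSpace.exp (t • A) x)) t := by
  have h := hasDerivAt_exp_smul_const' (𝕂 := ℝ) A t
  exact (((ContinuousLinearMap.apply ℂ E x).restrictScalars ℝ).hasFDerivAt.comp_hasDerivAt t h)

theorem norm_exp_smul_apply_le {A : E →L[ℂ] E} (hA : ∀ x, (inner ℂ x (A x)).re ≤ 0) (x : E)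
    {t : ℝ} (ht : 0 ≤ t) : ‖NormedSpace.exp (t • A) x‖ ≤ ‖x‖ := by
  have hd := fun t => hasDerivWithinAt_norm_sq_complex
    ((hasDerivAt_exp_smul_apply A x t).hasDerivWithinAt (s := Set.Ici 0))
  have h1 : AntitoneOn (fun t : ℝ => ‖NormedSpace.exp (t • A) x‖ ^ 2) (Set.Ici 0) := by
    refine antitoneOn_of_hasDerivWithinAt_nonpos (convex_Ici 0)
      (fun t _ => (hd t).continuousWithinAt) (fun t _ => (hd t).mono interior_subset)
      fun t _ => ?_
    have := hA (NormedSpace.exp (t • A) x)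
    linarith
  have h2 := h1 Set.self_mem_Ici ht ht
  simp only [zero_smul, NormedSpace.exp_zero, one_apply_eq_self] at h2
  exact (sq_le_sq₀ (norm_nonneg _) (norm_nonneg _)).1 h2

/-- An m-dissipative operator has a classical solution for every initial value in the domain of
its square. -/
theorem IsMDissipativeOp.exists_classicalSolution (hT : IsMDissipativeOp T) {x y y₂ : E}
    (hx : (x, y) ∈ T.graph) (hy : (y, y₂) ∈ T.graph) :
    ∃ z : ℝ → E, IsClassicalSolution T z ∧ z 0 = x := by
  obtain ⟨J, h1, h2, h3, h4⟩ := hT.exists_approximation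
  let A : ℕ → E →L[ℂ] E := fun n => ((n : ℂ) + 1) • (J n - 1)
  have hAJ : ∀ n x, A n x = ((n : ℂ) + 1) • (J n x - x) := fun n x => rfl
  have hAg : ∀ n u g, (u, g) ∈ T.graph → A n u = J n g := fun n u g h => h2 n u g h
  have hA : ∀ n x, (inner ℂ x (A n x)).re ≤ 0 := by
    intro n x
    have e1 : ((n : ℂ) + 1) = (((n : ℝ) + 1 : ℝ) : ℂ) := by push_cast; rfl
    rw [hAJ, inner_smul_right, e1, Complex.re_ofReal_mul, inner_sub_right, Complex.sub_re]
    refine mul_nonpos_of_nonneg_of_nonpos (by positivity) ?_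
    have e2 : (inner ℂ x (J n x)).re ≤ ‖x‖ * ‖x‖ :=
      (Complex.re_le_norm _).trans ((norm_inner_le_norm _ _).trans (by
        gcongr
        exact h3 n x))
    have e3 : (inner ℂ x x).re = ‖x‖ * ‖x‖ := inner_self_eq_norm_mul_norm (𝕜 := ℂ) x
    linarith
  -- Resolvent identity, multiplied by `n - m` to avoid division.
  have hJc : ∀ n m, Commute (J n) (J m) := by
    intro n m
    rcases eq_or_ne n m with rfl | hnm
    · exact Commute.refl _
    refine ContinuousLinearMap.ext fun f => ?_
    have e1 : ∀ n m : ℕ, ((n : ℂ) - m) • J n (J m f) =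
        ((n : ℂ) + 1) • J m f - ((m : ℂ) + 1) • J n f := by
      intro n m
      have := h2 n _ _ (h1 m f)
      rw [map_smul, map_sub, smul_sub, smul_sub] at this
      rw [show ((n : ℂ) - m) = ((n : ℂ) + 1) - (m + 1) by ring, sub_smul, sub_eq_sub_iff_add_eq_add]
      rw [sub_eq_sub_iff_add_eq_add] at this
      rw [this]
      abel
    have e2 : ((n : ℂ) - m) • J n (J m f) = ((n : ℂ) - m) • J m (J n f) := by
      rw [e1 n m, ← neg_sub (m : ℂ) n, neg_smul, e1 m n, neg_sub]
    exact smul_right_injective E (sub_ne_zero.2 (Nat.cast_injective.ne hnm)) e2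
  have hAc : ∀ n m, Commute (A n) (A m) := fun n m =>
    ((((hJc n m).sub_right (Commute.one_right _)).sub_left (Commute.one_left _)).smul_left
      _).smul_right _
  let S : ℕ → ℝ → E →L[ℂ] E := fun n t => NormedSpace.exp (t • A n)
  have hSd : ∀ n x t, HasDerivAt (fun t => S n t x) (A n (S n t x)) t := fun n x t =>
    hasDerivAt_exp_smul_apply (A n) x t
  have hS1 : ∀ n x t, 0 ≤ t → ‖S n t x‖ ≤ ‖x‖ := fun n x t ht => norm_exp_smul_apply_le (hA n) x ht
  have hS0 : ∀ n x, S n 0 x = x := fun n x => by simp [S]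
  have hSA : ∀ n m t x, A n (S m t x) = S m t (A n x) := fun n m t x =>
    congrArg (fun L : E →L[ℂ] E => L x) (((hAc n m).smul_right t).exp_right).eq
  -- By commutation, `S n t u - S m t u` solves the equation of `A n` with forcing `S m t (A n u - A
  -- m u)`, which is small because `A n u = J n g` converges.
  have hdiff : ∀ u g, (u, g) ∈ T.graph → ∀ n m t, 0 ≤ t →
      ‖S n t u - S m t u‖ ≤ Real.exp t * ‖J n g - J m g‖ := by
    intro u g hu n m t ht
    refine norm_le_exp_mul_of_hasDerivWithinAt (e := fun t => S n t u - S m t u)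
      (q := fun t => A n (S n t u - S m t u)) (r := fun t => S m t (A n u - A m u))
      (fun t _ => ?_) (fun t _ => hA n _) (fun t ht => ?_) (by simp [hS0]) ht
    · refine (((hSd n u t).sub (hSd m u t)).hasDerivWithinAt).congr_deriv ?_
      rw [map_sub, map_sub, ← hSA, ← hSA]
      abel
    · rw [← hAg n u g hu, ← hAg m u g hu]
      exact hS1 m _ t ht
  have hlim : ∀ u g, (u, g) ∈ T.graph → ∃ z : ℝ → E, ∀ n t, 0 ≤ t →
      ‖S n t u - z t‖ ≤ Real.exp t * ‖J n g - g‖ := by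
    intro u g hu
    have hc : ∀ t, 0 ≤ t → CauchySeq fun n => S n t u := by
      intro t ht
      rw [Metric.cauchySeq_iff]
      intro ε hε
      obtain ⟨N, hN⟩ := Metric.cauchySeq_iff.1 (h4 g).cauchySeq (ε / Real.exp t) (by positivity)
      refine ⟨N, fun m hm n hn => ?_⟩
      have := hN m hm n hn
      rw [dist_eq_norm, lt_div_iff₀' (Real.exp_pos t)] at this
      rw [dist_eq_norm]
      exact (hdiff u g hu m n t ht).trans_lt this
    have hz : ∀ t, ∃ z, 0 ≤ t → Tendsto (fun n => S n t u) atTop (𝓝 z) := by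
      intro t
      by_cases ht : 0 ≤ t
      · obtain ⟨z, hz⟩ := cauchySeq_tendsto_of_complete (hc t ht)
        exact ⟨z, fun _ => hz⟩
      · exact ⟨0, fun h => absurd h ht⟩
    choose z hz using hz
    refine ⟨z, fun n t ht => ?_⟩
    exact le_of_tendsto_of_tendsto' ((hz t ht).const_sub _).norm
      (((h4 g).const_sub _).norm.const_mul _) fun m => hdiff u g hu n m t ht
  obtain ⟨z, hz⟩ := hlim x y hx
  -- `w` is the candidate for `z'`. The same estimate applies to it because `y = T x` is again in
  -- the domain.
  obtain ⟨w, hw⟩ := hlim y y₂ hy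
  have hJ0 : ∀ g, Tendsto (fun n => ‖J n g - g‖) atTop (𝓝 0) := fun g => by
    simpa using ((h4 g).sub_const g).norm
  have hSz : ∀ t, 0 ≤ t → Tendsto (fun n => S n t x) atTop (𝓝 (z t)) := fun t ht =>
    tendsto_iff_norm_sub_tendsto_zero.2 (squeeze_zero (fun _ => norm_nonneg _)
      (fun n => hz n t ht) (by simpa using (hJ0 y).const_mul (Real.exp t)))
  have hder : ∀ n t, A n (S n t x) = S n t (J n y) := fun n t => by
    rw [hSA, hAg n x y hx]
  have hSw : ∀ n t, 0 ≤ t →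
      ‖S n t (J n y) - w t‖ ≤ ‖J n y - y‖ + Real.exp t * ‖J n y₂ - y₂‖ := by
    intro n t ht
    calc ‖S n t (J n y) - w t‖ = ‖S n t (J n y - y) + (S n t y - w t)‖ := by
          rw [map_sub]; congr 1; abel
      _ ≤ _ := (norm_add_le _ _).trans (add_le_add (hS1 n _ t ht) (hw n t ht))
  have hb0 : ∀ t, Tendsto (fun n => ‖J n y - y‖ + Real.exp t * ‖J n y₂ - y₂‖) atTop (𝓝 0) :=
    fun t => by simpa using (hJ0 y).add ((hJ0 y₂).const_mul (Real.exp t))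
  have hwc : ContinuousOn w (Set.Ici 0) := by
    have hu : TendstoLocallyUniformlyOn (fun n t => S n t (J n y)) w atTop (Set.Ici 0) := by
      rw [Metric.tendstoLocallyUniformlyOn_iff]
      intro ε hε t _
      refine ⟨Set.Iic (t + 1) ∩ Set.Ici 0, ?_, ?_⟩
      · rw [Set.inter_comm]
        exact inter_mem_nhdsWithin _ (Iic_mem_nhds (by linarith))
      · filter_upwards [(hb0 (t + 1)).eventually_lt_const hε] with n hn s hs
        rw [dist_comm, dist_eq_norm]
        refine ((hSw n s hs.2).trans ?_).trans_lt hn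
        gcongr
        exact hs.1
    refine hu.continuousOn (Eventually.of_forall fun n => ?_).frequently
    exact (continuous_iff_continuousAt.2 fun t => (hSd n (J n y) t).continuousAt).continuousOn
  let W : ℝ → E := fun t => w (max t 0)
  have hW : Continuous W := hwc.comp_continuous (by fun_prop) fun t => le_max_right t 0
  have hint : ∀ t, 0 ≤ t → z t = x + ∫ s in (0 : ℝ)..t, W s := by
    intro t ht
    have e1 : ∀ n, S n t x - x = ∫ s in (0 : ℝ)..t, S n s (J n y) := by
      intro n
      have hc : Continuous fun s => S n s (J n y) :=
        continuous_iff_continuousAt.2 fun t => (hSd n (J n y) t).continuousAt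
      rw [intervalIntegral.integral_eq_sub_of_hasDerivAt (f := fun t => S n t x)
        (fun s _ => by rw [← hder]; exact hSd n x s) (hc.intervalIntegrable _ _), hS0]
    have e2 : Tendsto (fun n => S n t x - x) atTop (𝓝 (∫ s in (0 : ℝ)..t, W s)) := by
      rw [tendsto_iff_norm_sub_tendsto_zero]
      refine squeeze_zero (fun _ => norm_nonneg _) (fun n => ?_)
        (by simpa using (hb0 t).mul_const t)
      have hc : Continuous fun s => S n s (J n y) :=
        continuous_iff_continuousAt.2 fun t => (hSd n (J n y) t).continuousAt
      rw [e1, ← intervalIntegral.integral_sub (hc.intervalIntegrable _ _)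
        (hW.intervalIntegrable _ _)]
      have := intervalIntegral.norm_integral_le_of_norm_le_const (a := 0) (b := t)
        (f := fun s => S n s (J n y) - W s)
        (C := ‖J n y - y‖ + Real.exp t * ‖J n y₂ - y₂‖) fun s hs => by
          rw [Set.uIoc_of_le ht] at hs
          simp only [W, max_eq_left hs.1.le]
          refine (hSw n s hs.1.le).trans ?_
          gcongr
          exact hs.2
      rwa [sub_zero, abs_of_nonneg ht] at this
    have e3 := tendsto_nhds_unique ((hSz t ht).sub_const x) e2
    rw [← e3]
    abel
  refine ⟨z, ⟨w, hwc, fun t ht => ⟨?_, ?_⟩⟩, ?_⟩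
  -- `T (J n (S n t x)) = A n (S n t x)` tends to `w t`, and the graph is closed.
  · refine hT.isClosed_graph.mem_of_tendsto (Tendsto.prodMk_nhds (f := atTop)
      (mx := fun n => J n (S n t x)) (my := fun n => A n (S n t x)) ?_ ?_)
      (Eventually.of_forall fun n => h1 n (S n t x))
    · rw [tendsto_iff_norm_sub_tendsto_zero]
      refine squeeze_zero (fun _ => norm_nonneg _) (g := fun n => ‖S n t x - z t‖ +
        ‖J n (z t) - z t‖) (fun n => ?_) ?_
      · calc ‖J n (S n t x) - z t‖ = ‖J n (S n t x - z t) + (J n (z t) - z t)‖ := by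
              rw [map_sub]; congr 1; abel
          _ ≤ _ := (norm_add_le _ _).trans (by gcongr; exact h3 _ _)
      · simpa using (tendsto_iff_norm_sub_tendsto_zero.1 (hSz t ht)).add (hJ0 (z t))
    · simp only [hder]
      exact tendsto_iff_norm_sub_tendsto_zero.2 (squeeze_zero (fun _ => norm_nonneg _)
        (fun n => hSw n t ht) (hb0 t))
  · have e1 : HasDerivAt (fun t => x + ∫ s in (0 : ℝ)..t, W s) (W t) t :=
      (hW.integral_hasStrictDerivAt 0 t).hasDerivAt.const_add x
    have e2 : W t = w t := by simp only [W, max_eq_left ht]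
    rw [e2] at e1
    exact e1.hasDerivWithinAt.congr (fun s hs => hint s hs) (hint t ht)
  · simpa using hint 0 le_rfl

/-- Exponential stability bounds the resolvent of an m-dissipative operator on the imaginary
axis. -/
theorem IsMDissipativeOp.exists_bound_of_isExponentiallyStable (hT : IsMDissipativeOp T)
    (hs : IsExponentiallyStable T) : ∃ M : ℝ, 0 ≤ M ∧
      ∀ (w : ℝ) (z f : E), (z, f) ∈ T.graph → ‖z‖ ≤ M * ‖(Complex.I * (w : ℂ)) • z - f‖ := by
  obtain ⟨c, ω, hc, hω, hs⟩ := hs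
  -- A factor `1/4` in the energy is a factor `1/2` in the norm.
  obtain ⟨t, ht0, ht⟩ : ∃ t : ℝ, 0 ≤ t ∧ c * Real.exp (-ω * t) ≤ 1 / 4 := by
    have h1 : Tendsto (fun t : ℝ => c * Real.exp (-ω * t)) atTop (𝓝 0) := by
      have : Tendsto (fun t : ℝ => -ω * t) atTop atBot :=
        tendsto_id.const_mul_atTop_of_neg (neg_lt_zero.2 hω)
      simpa using (Real.tendsto_exp_atBot.comp this).const_mul c
    obtain ⟨t, h2, h3⟩ := ((eventually_ge_atTop (0 : ℝ)).and
      (h1.eventually_lt_const (by norm_num : (0 : ℝ) < 1 / 4))).exists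
    exact ⟨t, h2, h3.le⟩
  have key : ∀ (w : ℝ) (x y y₂ : E), (x, y) ∈ T.graph → (y, y₂) ∈ T.graph →
      ‖x‖ ≤ 2 * Real.exp t * ‖(Complex.I * (w : ℂ)) • x - y‖ := by
    intro w x y y₂ hx hy
    obtain ⟨z, hz, hz0⟩ := hT.exists_classicalSolution hx hy
    have h1 := hs ⟨x, LinearPMap.mem_domain_of_mem_graph hx⟩ z hz hz0 t ht0
    rw [hz0] at h1
    have h2 : ‖z t‖ ≤ 1 / 2 * ‖x‖ := by
      refine (sq_le_sq₀ (norm_nonneg _) (by positivity)).1 ?_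
      nlinarith [sq_nonneg ‖x‖]
    obtain ⟨z', -, h⟩ := hz
    let p : ℝ → ℂ := fun t => Complex.exp (Complex.I * w * t)
    have hp : ∀ t, HasDerivAt p (p t * (Complex.I * w)) t := fun t => by
      have := ((hasDerivAt_id (t : ℂ)).const_mul (Complex.I * (w : ℂ))).cexp.comp_ofReal
      simpa [p] using this
    have hp1 : ∀ t, ‖p t‖ = 1 := fun t => by
      simp only [p]
      rw [show Complex.I * (w : ℂ) * t = ((w * t : ℝ) : ℂ) * Complex.I by push_cast; ring,
        Complex.norm_exp_ofReal_mul_I]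
    -- The difference from `exp(iwt) x` vanishes at `0` and solves the equation with a forcing of
    -- constant norm `‖iw x - y‖`.
    have h3 : ‖z t - p t • x‖ ≤ Real.exp t * ‖(Complex.I * (w : ℂ)) • x - y‖ := by
      refine norm_le_exp_mul_of_hasDerivWithinAt (e := fun t => z t - p t • x)
        (q := fun t => z' t - p t • y) (r := fun t => p t • (y - (Complex.I * (w : ℂ)) • x))
        (fun t ht => ?_) (fun t ht => ?_) (fun t _ => ?_) (by simp [p, hz0]) ht0
      · refine ((h t ht).2.sub ((hp t).smul_const x).hasDerivWithinAt).congr_deriv ?_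
        rw [mul_smul, smul_sub]
        abel
      · exact hT.re_inner_nonpos (T.graph.sub_mem (h t ht).1 (T.graph.smul_mem (p t) hx))
      · rw [norm_smul, hp1, one_mul, norm_sub_rev]
    have h4 : ‖x‖ ≤ ‖z t‖ + ‖z t - p t • x‖ := by
      have h5 : ‖p t • x‖ = ‖x‖ := by rw [norm_smul, hp1, one_mul]
      rw [← h5]
      calc ‖p t • x‖ = ‖z t - (z t - p t • x)‖ := by rw [sub_sub_cancel]
        _ ≤ _ := norm_sub_le _ _
    linarith
  refine ⟨2 * Real.exp t, by positivity, fun w x y hx => ?_⟩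
  -- Removes the restriction to the domain of `T²`: `J n x` lies there, and `T (J n x) = J n y`.
  obtain ⟨J, h1, h2, -, h4⟩ := hT.exists_approximation
  refine le_of_tendsto_of_tendsto' (h4 x).norm
    ((h4 ((Complex.I * (w : ℂ)) • x - y)).norm.const_mul _) fun n => ?_
  have e1 := h1 n x
  rw [h2 n x y hx] at e1
  have := key w _ _ _ e1 (h1 n y)
  rwa [← map_smul, ← map_sub] at this

end Yosida

/-! ### The generator of the coupled system -/

section SystemGenerator

variable {V X U : Type*}
  [NormedAddCommGroup V] [InnerProductSpace ℂ V]
  [NormedAddCommGroup X] [InnerProductSpace ℂ X]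
  [NormedAddCommGroup U] [InnerProductSpace ℂ U]

/-- The first two components of `f = 𝒜 z`, which do not involve the operator on `U`. -/
def IsWaveRelation (ι : V →L[ℂ] X) (B : U →L[ℂ] (V →L⋆[ℂ] ℂ)) (z f : EnergySpace V X U) : Prop :=
  ι f.fst = z.snd.fst ∧
    ∀ φ : V, inner ℂ (ι φ) f.snd.fst = -(inner ℂ φ z.fst + B z.snd.snd φ)

variable {ι : V →L[ℂ] X} {B : U →L[ℂ] (V →L⋆[ℂ] ℂ)} {z f z' f' : EnergySpace V X U}

theorem IsWaveRelation.add (h : IsWaveRelation ι B z f) (h' : IsWaveRelation ι B z' f') :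
    IsWaveRelation ι B (z + z') (f + f') := by
  refine ⟨?_, fun φ => ?_⟩
  · simp [h.1, h'.1]
  · have h1 := h.2 φ
    have h2 := h'.2 φ
    simp only [WithLp.add_snd, WithLp.add_fst, inner_add_right, map_add, h1, h2,
      add_apply]
    ring

theorem IsWaveRelation.neg (h : IsWaveRelation ι B z f) : IsWaveRelation ι B (-z) (-f) := by
  refine ⟨?_, fun φ => ?_⟩
  · simp [h.1]
  · have h1 := h.2 φ
    simp only [WithLp.neg_snd, WithLp.neg_fst, inner_neg_right, map_neg, h1,
      neg_apply]
    ring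

variable [CompleteSpace U]

/-- Testing the wave equation with the velocity cancels the `a` terms against each other, and the
`B` and `B*` terms likewise; only the operator on `U` can dissipate. -/
theorem IsWaveRelation.re_inner_eq (h : IsWaveRelation ι B z f) :
    (inner ℂ z f).re = (inner ℂ z.snd.snd (f.snd.snd - adjointControl B f.fst)).re := by
  have h1 := h.2 f.fst
  rw [h.1] at h1
  have h2 : B z.snd.snd f.fst = inner ℂ (adjointControl B f.fst) z.snd.snd :=
    (inner_adjointControl B _ _).symm
  have h0 : inner ℂ z f = inner ℂ z.fst f.fst +
      (inner ℂ z.snd.fst f.snd.fst + inner ℂ z.snd.snd f.snd.snd) := by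
    rw [WithLp.prod_inner_apply, WithLp.prod_inner_apply]
    rfl
  rw [h0, h1, h2, inner_sub_right]
  have h3 : (inner ℂ z.fst f.fst).re = (inner ℂ f.fst z.fst).re := inner_re_symm (𝕜 := ℂ) _ _
  have h4 : (inner ℂ z.snd.snd (adjointControl B f.fst)).re =
    (inner ℂ (adjointControl B f.fst) z.snd.snd).re := inner_re_symm (𝕜 := ℂ) _ _
  simp only [Complex.add_re, Complex.neg_re, Complex.sub_re, h3, h4]
  ring

variable {K : U →ₗ.[ℂ] U}

theorem mem_systemOp_graph_iff (hι : Function.Injective ι) (hd : DenseRange ι) :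
    (z, f) ∈ (systemOp ι B K).graph ↔
      IsWaveRelation ι B z f ∧ (z.snd.snd, f.snd.snd - adjointControl B f.fst) ∈ K.graph := by
  rw [systemOp_graph ι hι hd B K]
  constructor
  · rintro ⟨y, h1, h2, h3, h4⟩
    obtain rfl : f.fst = y := h2
    exact ⟨⟨h1, h3⟩, h4⟩
  · rintro ⟨⟨h1, h3⟩, h4⟩
    exact ⟨f.fst, h1, rfl, h3, h4⟩

/-- For the range condition at `1`, eliminate the velocity and then `x`. With `b = B*` and `S = (1 +
ι*ι)⁻¹`, what remains is an equation for `1 + b S b* - K` on `U`, where `b S b*` is bounded and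
accretive. -/
theorem IsMDissipativeOp.systemOp [CompleteSpace V] [CompleteSpace X]
    (hι : Function.Injective ι) (hd : DenseRange ι) (hK : IsMDissipativeOp K) :
    IsMDissipativeOp (systemOp ι B K) := by
  refine ⟨fun z => ?_, 1, one_pos, fun f => ?_⟩
  · obtain ⟨h1, h2⟩ := (mem_systemOp_graph_iff hι hd).1 ((_root_.systemOp ι B K).mem_graph z)
    rw [h1.re_inner_eq]
    exact hK.re_inner_nonpos h2
  · let b := adjointControl B
    let b' := ContinuousLinearMap.adjoint b
    let ι' := ContinuousLinearMap.adjoint ι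
    obtain ⟨S, hS⟩ := ContinuousLinearMap.exists_one_add_inverse (ι'.comp ι) fun u => by
      rw [ContinuousLinearMap.comp_apply, ContinuousLinearMap.adjoint_inner_right]
      exact inner_self_nonneg (𝕜 := ℂ)
    have hP : ∀ u, 0 ≤ (inner ℂ u ((b.comp (S.comp b')) u)).re := by
      intro u
      have h1 : inner ℂ u (b (S (b' u))) = inner ℂ (b' u) (S (b' u)) :=
        (ContinuousLinearMap.adjoint_inner_left b _ _).symm
      have h2 := hS (b' u)
      simp only [ContinuousLinearMap.comp_apply]
      rw [h1]
      nth_rewrite 1 [← h2]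
      rw [inner_add_left, ContinuousLinearMap.comp_apply, ContinuousLinearMap.adjoint_inner_left]
      exact add_nonneg (inner_self_nonneg (𝕜 := ℂ)) (inner_self_nonneg (𝕜 := ℂ))
    obtain ⟨u, k, hk, h⟩ := hK.surjective_add_bounded _ hP (l := 1) (by simp)
      (f.snd.snd - b f.fst + b (S (ι' (f.snd.fst + ι f.fst))))
    let x : V := S (ι' (f.snd.fst + ι f.fst) - b' u)
    have hx : x + ι' (ι x) = ι' (f.snd.fst + ι f.fst) - b' u := hS _
    let z : EnergySpace V X U := WithLp.toLp 2 (x, WithLp.toLp 2 (ι (x - f.fst), u))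
    have hz : (z, z - f) ∈ (_root_.systemOp ι B K).graph := by
      rw [mem_systemOp_graph_iff hι hd]
      refine ⟨⟨rfl, fun φ => ?_⟩, ?_⟩
      · have h1 := congrArg (fun v => inner ℂ φ v) hx
        simp only [inner_add_right, inner_sub_right, b', ι', map_add,
          ContinuousLinearMap.adjoint_inner_right] at h1
        have h2 : inner ℂ (b φ) u = B u φ := inner_adjointControl B φ u
        rw [h2] at h1
        change inner ℂ (ι φ) (ι (x - f.fst) - f.snd.fst) = -(inner ℂ φ x + B u φ)
        rw [map_sub, inner_sub_right, inner_sub_right]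
        linear_combination h1
      · change (u, u - f.snd.snd - b (x - f.fst)) ∈ K.graph
        convert hk using 2
        simp only [ContinuousLinearMap.comp_apply, one_smul] at h
        simp only [x, map_sub]
        rw [sub_eq_iff_eq_add] at h
        rw [eq_comm, ← sub_eq_iff_eq_add'] at h
        rw [← h]
        abel
    obtain ⟨y, hy, hy'⟩ := (LinearPMap.mem_graph_iff _).1 hz
    refine ⟨y, ?_⟩
    rw [hy', hy, Complex.ofReal_one, one_smul, sub_sub_cancel]

end SystemGenerator

/-! ### Skew-adjoint operators and their regularisations -/

section Skew

variable {U : Type*} [NormedAddCommGroup U] [InnerProductSpace ℂ U]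
  {C : U →ₗ.[ℂ] U}

theorem LinearPMap.mem_neg_graph_iff {u k : U} : (u, k) ∈ (-C).graph ↔ (u, -k) ∈ C.graph := by
  simp only [LinearPMap.mem_graph_iff]
  constructor
  · rintro ⟨y, hy, hy'⟩
    exact ⟨y, hy, by rw [← hy', LinearPMap.neg_apply, neg_neg]⟩
  · rintro ⟨y, hy, hy'⟩
    exact ⟨y, hy, by rw [LinearPMap.neg_apply, hy', neg_neg]⟩

/-- `v = (1 - ε²C²)⁻¹ u`, in terms of the graph of `C`. -/
def IsRegularization (C : U →ₗ.[ℂ] U) (ε : ℝ) (u v : U) : Prop :=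
  ∃ c d, (v, c) ∈ C.graph ∧ (c, d) ∈ C.graph ∧ v - ((ε : ℂ) ^ 2) • d = u

variable {W : Type*} [NormedAddCommGroup W] [InnerProductSpace ℂ W] {Dst : C.domain →ₗ[ℂ] W}

theorem hasDualValue_iff {u : U} {y : W} : HasDualValue C Dst u y ↔ ∃ v : ℝ → C.domain,
    (∀ ε, 0 < ε → IsRegularization C ε u (v ε)) ∧ Tendsto (fun ε => Dst (v ε)) (𝓝[>] 0) (𝓝 y) := by
  constructor
  · rintro ⟨v, h, ht⟩
    refine ⟨v, fun ε hε => ?_, ht⟩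
    obtain ⟨h1, h2⟩ := h ε hε
    exact ⟨C (v ε), C ⟨C (v ε), h1⟩, C.mem_graph _, C.mem_graph ⟨C (v ε), h1⟩, h2⟩
  · rintro ⟨v, h, ht⟩
    refine ⟨v, fun ε hε => ?_, ht⟩
    obtain ⟨c, d, h1, h2, h3⟩ := h ε hε
    obtain ⟨x, hx, hx'⟩ := C.mem_graph_iff.1 h1
    obtain rfl : x = v ε := Subtype.ext hx
    obtain ⟨e, he, he'⟩ := C.mem_graph_iff.1 h2
    have hc : C (v ε) ∈ C.domain := by rw [hx']; exact LinearPMap.mem_domain_of_mem_graph h2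
    refine ⟨hc, ?_⟩
    rw [show (⟨C (v ε), hc⟩ : C.domain) = e from Subtype.ext (hx'.trans he.symm), he']
    exact h3

theorem HasDualValue.add {u u' : U} {y y' : W} (h : HasDualValue C Dst u y)
    (h' : HasDualValue C Dst u' y') : HasDualValue C Dst (u + u') (y + y') := by
  obtain ⟨v, h1, h2⟩ := hasDualValue_iff.1 h
  obtain ⟨v', h1', h2'⟩ := hasDualValue_iff.1 h'
  refine hasDualValue_iff.2 ⟨fun ε => v ε + v' ε, fun ε hε => ?_, by simpa using h2.add h2'⟩
  obtain ⟨c, d, k1, k2, k3⟩ := h1 ε hε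
  obtain ⟨c', d', k1', k2', k3'⟩ := h1' ε hε
  refine ⟨c + c', d + d', C.graph.add_mem k1 k1', C.graph.add_mem k2 k2', ?_⟩
  rw [← k3, ← k3', smul_add, Submodule.coe_add]
  abel

theorem HasDualValue.neg {u : U} {y : W} (h : HasDualValue C Dst u y) :
    HasDualValue C Dst (-u) (-y) := by
  obtain ⟨v, h1, h2⟩ := hasDualValue_iff.1 h
  refine hasDualValue_iff.2 ⟨fun ε => -v ε, fun ε hε => ?_, by simpa using h2.neg⟩
  obtain ⟨c, d, k1, k2, k3⟩ := h1 ε hε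
  refine ⟨-c, -d, C.graph.neg_mem k1, C.graph.neg_mem k2, ?_⟩
  rw [← k3, smul_neg, Submodule.coe_neg]
  abel

variable [CompleteSpace U]

theorem IsSkewAdjointOp.mem_graph_iff (hC : IsSkewAdjointOp C) {u k : U} :
    (u, k) ∈ C.graph ↔ ∀ p q, (p, q) ∈ C.graph → inner ℂ p k = -inner ℂ q u := by
  constructor
  · intro h p q hpq
    obtain ⟨v, rfl, rfl⟩ := C.mem_graph_iff.1 hpq
    obtain ⟨u, rfl, rfl⟩ := C.mem_graph_iff.1 h
    have hv : (v : U) ∈ C.adjoint.domain := by rw [hC.2]; exact v.2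
    have h1 := C.adjoint_isFormalAdjoint hC.1 ⟨v, hv⟩ u
    have h2 : C.adjoint ⟨v, hv⟩ = -C v := @(LinearPMap.ext_iff.1 hC.2).2 v hv v.2
    rw [h2, inner_neg_left] at h1
    exact h1.symm
  · intro h
    have h1 : ∀ v : C.domain, inner ℂ (-k) (v : U) = inner ℂ u (C v) := fun v => by
      have := h v (C v) (C.mem_graph v)
      rw [← inner_conj_symm, inner_neg_right, this, neg_neg, inner_conj_symm]
    have hu : u ∈ C.adjoint.domain := C.mem_adjoint_domain_of_exists u ⟨-k, h1⟩
    have h2 : C.adjoint ⟨u, hu⟩ = -k := C.adjoint_apply_eq hC.1 ⟨u, hu⟩ h1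
    have h3 : (u, -k) ∈ C.adjoint.graph := h2 ▸ C.adjoint.mem_graph ⟨u, hu⟩
    rw [hC.2, LinearPMap.mem_graph_iff] at h3
    obtain ⟨y, hy, hy'⟩ := h3
    rw [LinearPMap.neg_apply, neg_inj] at hy'
    exact C.mem_graph_iff.2 ⟨y, hy, hy'⟩

/-- For such `C`, `‖u - Cu‖² = ‖u‖² + ‖Cu‖²`, so `1 - C` has closed range. The hypothesis is
symmetric under `C ↦ -C`, which covers both signs. -/
theorem isMDissipativeOp_of_mem_graph_iff
    (h : ∀ u k, (u, k) ∈ C.graph ↔ ∀ p q, (p, q) ∈ C.graph → inner ℂ p k = -inner ℂ q u) :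
    IsMDissipativeOp C := by
  have hre : ∀ u k, (u, k) ∈ C.graph → (inner ℂ u k).re = 0 := by
    intro u k hu
    have h1 := congrArg Complex.re ((h u k).1 hu u k hu)
    have h2 : (inner ℂ u k).re = (inner ℂ k u).re := inner_re_symm (𝕜 := ℂ) _ _
    rw [Complex.neg_re] at h1
    linarith
  refine ⟨fun u => (hre _ _ (C.mem_graph u)).le, 1, one_pos, ?_⟩
  have hcl : IsClosed (C.graph : Set (U × U)) := by
    have : (C.graph : Set (U × U)) =
        ⋂ p : C.graph, {x | inner ℂ (p : U × U).1 x.2 = -inner ℂ (p : U × U).2 x.1} := by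
      ext ⟨u, k⟩
      rw [SetLike.mem_coe, h, Set.mem_iInter]
      exact ⟨fun hh p => hh _ _ p.2, fun hh p q hpq => hh ⟨(p, q), hpq⟩⟩
    rw [this]
    exact isClosed_iInter fun p => isClosed_eq (by fun_prop) (by fun_prop)
  have : CompleteSpace C.graph := hcl.completeSpace_coe
  let L : C.graph →L[ℂ] U :=
    (ContinuousLinearMap.fst ℂ U U - ContinuousLinearMap.snd ℂ U U).comp C.graph.subtypeL
  have hL : ∀ p : C.graph, L p = (p : U × U).1 - (p : U × U).2 := fun p => rfl
  have hsq : ∀ p : C.graph, ‖L p‖ ^ 2 = ‖(p : U × U).1‖ ^ 2 + ‖(p : U × U).2‖ ^ 2 := by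
    intro p
    have h1 := norm_sub_sq (𝕜 := ℂ) (p : U × U).1 (p : U × U).2
    have h2 : RCLike.re (inner ℂ (p : U × U).1 (p : U × U).2) = 0 := hre _ _ p.2
    rw [hL, h1, h2]
    ring
  have hanti : AntilipschitzWith 1 L := by
    refine L.antilipschitz_of_bound fun p => ?_
    have h1 := hsq p
    rw [NNReal.coe_one, one_mul]
    refine max_le ?_ ?_ <;> refine (sq_le_sq₀ (norm_nonneg _) (norm_nonneg _)).1 ?_
    · change ‖(p : U × U).1‖ ^ 2 ≤ _
      nlinarith [sq_nonneg ‖(p : U × U).2‖]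
    · change ‖(p : U × U).2‖ ^ 2 ≤ _
      nlinarith [sq_nonneg ‖(p : U × U).1‖]
  have hrc : IsClosed (LinearMap.range (L : C.graph →ₗ[ℂ] U) : Set U) := by
    rw [LinearMap.coe_range]
    exact hanti.isClosed_range L.uniformContinuous
  have htop : LinearMap.range (L : C.graph →ₗ[ℂ] U) = ⊤ := by
    rw [← hrc.submodule_topologicalClosure_eq, Submodule.topologicalClosure_eq_top_iff,
      Submodule.eq_bot_iff]
    intro z hz
    -- Orthogonality to the range of `1 - C` says that `z` is in the domain with `C z = -z`, which
    -- is impossible for `z ≠ 0`.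
    have h1 : (z, -z) ∈ C.graph := by
      rw [h]
      intro p q hpq
      have h2 : inner ℂ (p - q) z = 0 := hz _ ⟨⟨(p, q), hpq⟩, rfl⟩
      rw [inner_sub_left, sub_eq_zero] at h2
      rw [inner_neg_right, h2]
    have h2 := hre _ _ h1
    rw [inner_neg_right, Complex.neg_re, neg_eq_zero] at h2
    have h3 : ‖z‖ ^ 2 = 0 := (inner_self_eq_norm_sq (𝕜 := ℂ) z).symm.trans h2
    simpa using h3
  intro f
  obtain ⟨p, hp⟩ := htop ▸ Submodule.mem_top (x := f)
  obtain ⟨y, hy, hy'⟩ := C.mem_graph_iff.1 p.2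
  refine ⟨y, ?_⟩
  rw [hy, hy', Complex.ofReal_one, one_smul]
  exact hp

theorem IsSkewAdjointOp.isMDissipativeOp (hC : IsSkewAdjointOp C) : IsMDissipativeOp C :=
  isMDissipativeOp_of_mem_graph_iff fun _ _ => hC.mem_graph_iff

theorem IsSkewAdjointOp.isMDissipativeOp_neg (hC : IsSkewAdjointOp C) : IsMDissipativeOp (-C) := by
  refine isMDissipativeOp_of_mem_graph_iff fun u k => ?_
  rw [LinearPMap.mem_neg_graph_iff, hC.mem_graph_iff]
  constructor
  · intro h p q hpq
    have := h p (-q) (LinearPMap.mem_neg_graph_iff.1 hpq)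
    rwa [inner_neg_right, inner_neg_left, neg_inj] at this
  · intro h p q hpq
    have := h p (-q) (LinearPMap.mem_neg_graph_iff.2 (by rwa [neg_neg]))
    rw [inner_neg_right, this, inner_neg_left, neg_neg]

theorem IsSkewAdjointOp.re_inner_eq_zero (hC : IsSkewAdjointOp C) {u k : U}
    (h : (u, k) ∈ C.graph) : (inner ℂ u k).re = 0 := by
  refine le_antisymm (hC.isMDissipativeOp.re_inner_nonpos h) ?_
  have := hC.isMDissipativeOp_neg.re_inner_nonpos
    (LinearPMap.mem_neg_graph_iff.2 (by rwa [neg_neg] : (u, - -k) ∈ C.graph))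
  rw [inner_neg_right, Complex.neg_re] at this
  linarith

theorem IsSkewAdjointOp.exists_isRegularization (hC : IsSkewAdjointOp C) {ε : ℝ} (hε : 0 < ε)
    (u : U) : ∃ v, IsRegularization C ε u v := by
  have hl : 0 < ((ε⁻¹ : ℝ) : ℂ).re := by simpa using hε
  obtain ⟨P, hP, -⟩ := hC.isMDissipativeOp.exists_resolvent hl
  obtain ⟨N, hN, -⟩ := hC.isMDissipativeOp_neg.exists_resolvent hl
  set l : ℂ := ((ε⁻¹ : ℝ) : ℂ) with hldef
  have hle : (ε : ℂ) ^ 2 * l ^ 2 = 1 := by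
    rw [← mul_pow, hldef, ← Complex.ofReal_mul, mul_inv_cancel₀ hε.ne']
    simp
  have h1 := hP (N u)
  have h2 := LinearPMap.mem_neg_graph_iff.1 (hN u)
  have h3 := C.graph.sub_mem (C.graph.smul_mem l h1) h2
  -- With `l = 1/ε`, `1 - ε²C² = ε² (l - C)(l + C)`.
  refine ⟨l ^ 2 • P (N u), _, _, C.graph.smul_mem (l ^ 2) h1, C.graph.smul_mem (l ^ 2) h3, ?_⟩
  change l ^ 2 • P (N u) - ((ε : ℂ) ^ 2) • l ^ 2 • (l • (l • P (N u) - N u) - -(l • N u - u)) = u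
  rw [smul_smul, hle, one_smul, smul_sub, smul_smul, ← pow_two]
  abel

/-- Pair `u - a = (v - a) - ε² C² v` with `v - a`; skewness turns the last term into `ε² ⟨C(v - a),
Cv⟩`, bounded below by Young's inequality. A free `a` in the domain allows a density argument. -/
theorem IsSkewAdjointOp.norm_regularization_sub_sq_le (hC : IsSkewAdjointOp C) {ε : ℝ}
    {u v : U} (h : IsRegularization C ε u v) {a b : U} (ha : (a, b) ∈ C.graph) :
    ‖v - a‖ ^ 2 ≤ ‖u - a‖ ^ 2 + ε ^ 2 * ‖b‖ ^ 2 := by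
  obtain ⟨c, d, h1, h2, rfl⟩ := h
  have h3 := hC.mem_graph_iff.1 h2 _ _ (C.graph.sub_mem h1 ha)
  set e := v - a
  set g := c - b
  have h4 : inner ℂ e d = -(inner ℂ g g + inner ℂ g b) := by
    change inner ℂ e d = -inner ℂ g c at h3
    rw [h3, ← inner_add_right, sub_add_cancel]
  have h5 : inner ℂ e (v - ((ε : ℂ) ^ 2) • d - a) =
      inner ℂ e e + ((ε ^ 2 : ℝ) : ℂ) * (inner ℂ g g + inner ℂ g b) := by
    rw [show v - ((ε : ℂ) ^ 2) • d - a = e - ((ε : ℂ) ^ 2) • d by simp only [e]; abel,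
      inner_sub_right, inner_smul_right, h4]
    push_cast
    ring
  have h6 := congrArg Complex.re h5
  have e1 : ∀ x : U, (inner ℂ x x).re = ‖x‖ ^ 2 := fun x => inner_self_eq_norm_sq (𝕜 := ℂ) x
  rw [Complex.add_re, Complex.re_ofReal_mul, Complex.add_re, e1, e1] at h6
  have h7 : (inner ℂ e (v - ((ε : ℂ) ^ 2) • d - a)).re ≤ ‖e‖ * ‖v - ((ε : ℂ) ^ 2) • d - a‖ :=
    (Complex.re_le_norm _).trans (norm_inner_le_norm _ _)
  have h8 : -(inner ℂ g b).re ≤ ‖g‖ * ‖b‖ :=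
    (neg_le_abs _).trans ((Complex.abs_re_le_norm _).trans (norm_inner_le_norm _ _))
  have h9 : -(‖g‖ ^ 2 + (inner ℂ g b).re) ≤ ‖b‖ ^ 2 / 4 := by
    nlinarith [sq_nonneg (‖g‖ - ‖b‖ / 2)]
  have h10 := mul_le_mul_of_nonneg_left h9 (sq_nonneg ε)
  nlinarith [sq_nonneg (‖e‖ - ‖v - ((ε : ℂ) ^ 2) • d - a‖),
    mul_nonneg (sq_nonneg ε) (sq_nonneg ‖b‖)]

theorem IsSkewAdjointOp.tendsto_regularization (hC : IsSkewAdjointOp C) {u : U} {v : ℝ → U}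
    (h : ∀ ε, 0 < ε → IsRegularization C ε u (v ε)) : Tendsto v (𝓝[>] 0) (𝓝 u) := by
  rw [Metric.tendsto_nhds]
  intro η hη
  obtain ⟨a, ha, had⟩ := Metric.dense_iff.1 hC.1 u (η / 4) (by positivity)
  obtain ⟨b, hb⟩ := LinearPMap.mem_domain_iff.1 had
  rw [Metric.mem_ball, dist_comm, dist_eq_norm] at ha
  have h1 : Tendsto (fun ε : ℝ => ε ^ 2 * ‖b‖ ^ 2) (𝓝[>] 0) (𝓝 0) := by
    have : Continuous fun ε : ℝ => ε ^ 2 * ‖b‖ ^ 2 := by fun_prop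
    simpa using (this.tendsto 0).mono_left nhdsWithin_le_nhds
  filter_upwards [h1.eventually_lt_const (by positivity : (0 : ℝ) < (η / 4) ^ 2),
    self_mem_nhdsWithin] with ε hε1 hε
  have h2 := hC.norm_regularization_sub_sq_le (h ε hε) hb
  have h3 : ‖v ε - a‖ < η / 2 := by
    refine lt_of_pow_lt_pow_left₀ 2 (by positivity) ?_
    nlinarith [norm_nonneg (u - a)]
  rw [dist_eq_norm]
  calc ‖v ε - u‖ = ‖(v ε - a) - (u - a)‖ := by rw [sub_sub_sub_cancel_right]
    _ ≤ ‖v ε - a‖ + ‖u - a‖ := norm_sub_le _ _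
    _ < η := by linarith

/-- The extended `D*` agrees with `D*` on the domain of `C`. -/
theorem IsSkewAdjointOp.hasDualValue (hC : IsSkewAdjointOp C) (hD : IsGraphBounded C Dst)
    (u : C.domain) : HasDualValue C Dst u (Dst u) := by
  have hex : ∀ ε : ℝ, ∃ v : C.domain, 0 < ε → IsRegularization C ε u v := by
    intro ε
    by_cases hε : 0 < ε
    · obtain ⟨v, hv⟩ := hC.exists_isRegularization hε u
      have hv' := hv
      obtain ⟨c, d, h1, -⟩ := hv'
      exact ⟨⟨v, LinearPMap.mem_domain_of_mem_graph h1⟩, fun _ => hv⟩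
    · exact ⟨0, fun h => absurd h hε⟩
  choose v hv using hex
  refine hasDualValue_iff.2 ⟨v, hv, ?_⟩
  -- Regularisation commutes with `C`, because `v - u = ε² C² v` lies in the domain. Hence `v ε → u`
  -- in the graph norm, where `D*` is continuous.
  have hreg : ∀ ε, 0 < ε → IsRegularization C ε (C u) (C (v ε)) := by
    intro ε hε
    obtain ⟨c, d, h1, h2, h3⟩ := hv ε hε
    obtain rfl : c = C (v ε) := C.mem_graph_snd_inj h1 (C.mem_graph (v ε)) rfl
    have he : (ε : ℂ) ^ 2 ≠ 0 := by simpa using hε.ne'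
    have h4 := C.graph.smul_mem ((ε : ℂ) ^ 2)⁻¹
      (C.graph.sub_mem (C.mem_graph (v ε)) (C.mem_graph u))
    have h5 : d = ((ε : ℂ) ^ 2)⁻¹ • ((v ε : U) - u) := by
      rw [← h3, sub_sub_cancel, inv_smul_smul₀ he]
    refine ⟨d, ((ε : ℂ) ^ 2)⁻¹ • (C (v ε) - C u), h2, ?_, ?_⟩
    · rw [h5]
      exact h4
    · rw [smul_inv_smul₀ he, sub_sub_cancel]
  have t1 := hC.tendsto_regularization hv
  have t2 := hC.tendsto_regularization hreg
  obtain ⟨M, hM⟩ := hD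
  rw [tendsto_iff_norm_sub_tendsto_zero] at t1 t2 ⊢
  have t3 : Tendsto (fun ε => M * (‖(v ε : U) - u‖ ^ 2 + ‖C (v ε) - C u‖ ^ 2)) (𝓝[>] 0) (𝓝 0) := by
    simpa using ((t1.pow 2).add (t2.pow 2)).const_mul M
  have t4 : Tendsto (fun ε => ‖Dst (v ε) - Dst u‖ ^ 2) (𝓝[>] 0) (𝓝 0) := by
    refine squeeze_zero (fun _ => sq_nonneg _) (fun ε => ?_) t3
    have := hM (v ε - u)
    rwa [map_sub, LinearPMap.map_sub] at this
  simpa using t4.sqrt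

/-- Energy balance for `k = -Cu + Dw`. -/
theorem IsSkewAdjointOp.re_inner_eq_of_weak (hC : IsSkewAdjointOp C) {u k : U} {y w : W}
    (hy : HasDualValue C Dst u y)
    (h : ∀ v : C.domain, inner ℂ (v : U) k = inner ℂ (C v) u + inner ℂ (Dst v) w) :
    (inner ℂ u k).re = (inner ℂ y w).re := by
  obtain ⟨v, h1, h2⟩ := hasDualValue_iff.1 hy
  have t1 : Tendsto (fun ε => (inner ℂ (v ε : U) k).re) (𝓝[>] 0) (𝓝 (inner ℂ u k).re) :=
    (Complex.continuous_re.tendsto _).comp ((hC.tendsto_regularization h1).inner tendsto_const_nhds)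
  have t2 : Tendsto (fun ε => (inner ℂ (Dst (v ε)) w).re) (𝓝[>] 0) (𝓝 (inner ℂ y w).re) :=
    (Complex.continuous_re.tendsto _).comp (h2.inner tendsto_const_nhds)
  refine tendsto_nhds_unique (t1.congr' ?_) t2
  filter_upwards [self_mem_nhdsWithin] with ε hε
  obtain ⟨c, d, k1, k2, k3⟩ := h1 ε hε
  obtain rfl : c = C (v ε) := C.mem_graph_snd_inj k1 (C.mem_graph (v ε)) rfl
  have e1 := hC.re_inner_eq_zero k1
  have e2 := hC.re_inner_eq_zero k2
  have e3 : (inner ℂ (C (v ε)) (v ε : U)).re = 0 := by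
    rw [← e1]
    exact inner_re_symm (𝕜 := ℂ) _ _
  -- Substituting `u = v - ε² C² v`, both `⟨Cv, v⟩` and `⟨Cv, C² v⟩` are purely imaginary, so the
  -- skew term drops out before the limit.
  rw [h (v ε), ← k3, inner_sub_right, inner_smul_right, Complex.add_re, Complex.sub_re, e3]
  rw [show ((ε : ℂ) ^ 2) = ((ε ^ 2 : ℝ) : ℂ) by push_cast; rfl, Complex.re_ofReal_mul, e2]
  ring

end Skew

/-! ### The damped and the undamped system -/

section Stabilization

theorem le_mul_of_sq_le {x g a c : ℝ} (hx : 0 ≤ x) (hg : 0 ≤ g) (ha : 0 ≤ a) (hc : 0 ≤ c)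
    (h : x ^ 2 ≤ a * g ^ 2 + c * (x * g)) : x ≤ (a + c + 1) * g := by
  by_contra! hlt
  have k1 : g ≤ x := (le_mul_of_one_le_left hg (by linarith)).trans hlt.le
  have k2 : g ^ 2 ≤ x * g := by rw [sq]; gcongr
  have k3 := mul_le_mul_of_nonneg_left k2 ha
  have k4 : 0 < x := lt_of_le_of_lt (by positivity) hlt
  have k5 := mul_lt_mul_of_pos_left hlt k4
  have k6 := mul_nonneg hx hg
  have k7 : x * ((a + c + 1) * g) = a * (x * g) + c * (x * g) + x * g := by ring
  have k8 : x * x = x ^ 2 := (sq x).symm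
  linarith

variable {V X U W : Type*}
  [NormedAddCommGroup V] [InnerProductSpace ℂ V]
  [NormedAddCommGroup X] [InnerProductSpace ℂ X]
  [NormedAddCommGroup U] [InnerProductSpace ℂ U] [CompleteSpace U]
  [NormedAddCommGroup W] [InnerProductSpace ℂ W]

/-- `f = 𝒜_c z + (0, 0, D w)`, where the third component is an identity in `D(C)'`. -/
def IsControlledRelation (ι : V →L[ℂ] X) (B : U →L[ℂ] (V →L⋆[ℂ] ℂ)) (C : U →ₗ.[ℂ] U)
    (Dst : C.domain →ₗ[ℂ] W) (z f : EnergySpace V X U) (w : W) : Prop :=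
  IsWaveRelation ι B z f ∧ ∀ v : C.domain, inner ℂ (v : U) (f.snd.snd - adjointControl B f.fst) =
    inner ℂ (C v) z.snd.snd + inner ℂ (Dst v) w

variable {ι : V →L[ℂ] X} {B : U →L[ℂ] (V →L⋆[ℂ] ℂ)} {Chat C : U →ₗ.[ℂ] U}
  {Dst : C.domain →ₗ[ℂ] W} {z f z' f' : EnergySpace V X U} {w w' y : W}

theorem IsControlledRelation.add (h : IsControlledRelation ι B C Dst z f w)
    (h' : IsControlledRelation ι B C Dst z' f' w') :
    IsControlledRelation ι B C Dst (z + z') (f + f') (w + w') := by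
  refine ⟨h.1.add h'.1, fun v => ?_⟩
  have h1 := h.2 v
  have h2 := h'.2 v
  rw [inner_sub_right] at h1 h2
  simp only [WithLp.add_snd, WithLp.add_fst, inner_add_right, map_add, inner_sub_right]
  linear_combination h1 + h2

theorem IsControlledRelation.neg (h : IsControlledRelation ι B C Dst z f w) :
    IsControlledRelation ι B C Dst (-z) (-f) (-w) := by
  refine ⟨h.1.neg, fun v => ?_⟩
  have h1 := h.2 v
  rw [inner_sub_right] at h1
  simp only [WithLp.neg_snd, WithLp.neg_fst, inner_neg_right, map_neg, inner_sub_right]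
  linear_combination -h1

/-- Passivity: the undamped system gains energy only by pairing its input with its output `D*u`. -/
theorem IsControlledRelation.re_inner_eq (hC : IsSkewAdjointOp C)
    (h : IsControlledRelation ι B C Dst z f w) (hy : HasDualValue C Dst z.snd.snd y) :
    (inner ℂ z f).re = (inner ℂ y w).re := by
  rw [h.1.re_inner_eq]
  exact hC.re_inner_eq_of_weak hy h.2

/-- With zero input, skew-adjointness turns the weak identity in `D(C)'` into membership in `D(C)`.
This is how cancelling two inputs produces elements of the undamped domain. -/
theorem mem_conservativeOp_graph_iff (hι : Function.Injective ι) (hd : DenseRange ι)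
    (hC : IsSkewAdjointOp C) (Dst : C.domain →ₗ[ℂ] W) :
    (z, f) ∈ (conservativeOp ι B C).graph ↔ IsControlledRelation ι B C Dst z f 0 := by
  rw [conservativeOp, mem_systemOp_graph_iff hι hd, LinearPMap.mem_neg_graph_iff,
    hC.mem_graph_iff, IsControlledRelation]
  refine and_congr_right fun _ => ⟨fun h v => ?_, fun h p q hpq => ?_⟩
  · have := h v (C v) (C.mem_graph v)
    rwa [inner_neg_right, neg_inj, ← add_zero (inner ℂ (C v) _), ← inner_zero_right (Dst v)] at this
  · obtain ⟨v, rfl, rfl⟩ := C.mem_graph_iff.1 hpq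
    rw [inner_neg_right, h v, inner_zero_right, add_zero]

/-- Damping is the feedback `w = -D*u`. -/
theorem mem_dampedOp_graph_iff (hι : Function.Injective ι) (hd : DenseRange ι)
    (hsum : IsMinusSkewMinusDDStar Chat C Dst) :
    (z, f) ∈ (dampedOp ι B Chat).graph ↔
      ∃ y, HasDualValue C Dst z.snd.snd y ∧ IsControlledRelation ι B C Dst z f (-y) := by
  rw [dampedOp, mem_systemOp_graph_iff hι hd, hsum]
  constructor
  · rintro ⟨h1, y, h2, h3⟩
    exact ⟨y, h2, h1, fun v => by rw [h3 v, inner_neg_right, sub_eq_add_neg]⟩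
  · rintro ⟨y, h2, h1, h3⟩
    exact ⟨h1, y, h2, fun v => by rw [h3 v, inner_neg_right, sub_eq_add_neg]⟩

theorem hautusEstimate_iff (hι : Function.Injective ι) (hd : DenseRange ι)
    (hC : IsSkewAdjointOp C) (hD : IsGraphBounded C Dst) :
    HautusEstimate ι B C Dst ↔ ∃ δ : ℝ, 0 < δ ∧ ∀ (w : ℝ) (z f : EnergySpace V X U) (y : W),
      IsControlledRelation ι B C Dst z f 0 → HasDualValue C Dst z.snd.snd y →
        δ * ‖z‖ ^ 2 ≤ ‖(Complex.I * (w : ℂ)) • z - f‖ ^ 2 + ‖y‖ ^ 2 := by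
  refine exists_congr fun δ => and_congr_right fun _ => ⟨fun h w z f y hz hy => ?_,
    fun h w z => ?_⟩
  · obtain ⟨a, rfl, rfl⟩ := (LinearPMap.mem_graph_iff _).1
      ((mem_conservativeOp_graph_iff hι hd hC Dst).2 hz)
    rw [hy.unique hC (hC.hasDualValue hD ⟨_, conservativeOp_third_mem ι B C a⟩)]
    exact h w a
  · exact h w z _ _ ((mem_conservativeOp_graph_iff hι hd hC Dst).1 (LinearPMap.mem_graph _ z))
      (hC.hasDualValue hD ⟨_, conservativeOp_third_mem ι B C z⟩)

/-- The control-to-state map `p = (l - 𝒜_c)⁻¹ (0, 0, D w)` exists on the line `Re l = β`, and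
`D* p = G l w` with uniformly bounded `G l`. -/
def HasTransferFunction (ι : V →L[ℂ] X) (B : U →L[ℂ] (V →L⋆[ℂ] ℂ)) (C : U →ₗ.[ℂ] U)
    (Dst : C.domain →ₗ[ℂ] W) (β M : ℝ) (G : ℂ → W →L[ℂ] W) : Prop :=
  ∀ l : ℂ, l.re = β → ‖G l‖ ≤ M ∧ ∀ w : W, ∃ p : EnergySpace V X U,
    IsControlledRelation ι B C Dst p (l • p) w ∧ HasDualValue C Dst p.snd.snd (G l w)

/-- `G = -H`. As `x` solves `(l² + A) x = Bu`, the displacement is `-x` and the velocity `-l x`. -/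
theorem TransferEstimate.hasTransferFunction (h : TransferEstimate ι B C Dst) :
    ∃ β M G, 0 < β ∧ HasTransferFunction ι B C Dst β M G := by
  obtain ⟨H, h1, β, hβ, M, hM⟩ := h
  refine ⟨β, M, fun l => -H l, hβ, fun l hl => ⟨by rw [norm_neg]; exact hM l hl, fun w => ?_⟩⟩
  obtain ⟨u, ⟨x, hx, hu⟩, hd⟩ := h1 l (hl ▸ hβ) w
  refine ⟨WithLp.toLp 2 (-x, WithLp.toLp 2 (-(l • ι x), u)), ⟨⟨?_, fun φ => ?_⟩, fun v => ?_⟩, hd⟩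
  · change ι (l • -x) = -(l • ι x)
    simp
  · change inner ℂ (ι φ) (l • -(l • ι x)) = -(inner ℂ φ (-x) + B u φ)
    have := hx φ
    simp only [smul_neg, inner_neg_right, inner_smul_right]
    linear_combination -this
  · change inner ℂ (v : U) (l • u - adjointControl B (l • -x)) = inner ℂ (C v) u + inner ℂ (Dst v) w
    have := hu v
    simp only [smul_neg, map_neg, map_smul, inner_neg_right, inner_smul_right, inner_sub_right]
    linear_combination this

/-- For bounded `D` the transfer function is `D* Q (l - 𝒜_c)⁻¹ J D`, with `J` and `Q` the inclusion
of and projection onto `U`; on `Re l = 1` the resolvent is a contraction. -/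
theorem IsBoundedControl.hasTransferFunction [CompleteSpace V] [CompleteSpace X] [CompleteSpace W]
    (hι : Function.Injective ι) (hd : DenseRange ι) (hC : IsSkewAdjointOp C)
    (hDst : IsGraphBounded C Dst) (h : IsBoundedControl C Dst) :
    ∃ β M G, 0 < β ∧ HasTransferFunction ι B C Dst β M G := by
  obtain ⟨D, hD⟩ := h
  have hA : IsMDissipativeOp (conservativeOp ι B C) := hC.isMDissipativeOp_neg.systemOp hι hd
  have hR : ∀ l : ℂ, ∃ R : EnergySpace V X U →L[ℂ] EnergySpace V X U, l.re = 1 →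
      (∀ f, (R f, l • R f - f) ∈ (conservativeOp ι B C).graph) ∧ ∀ f, ‖R f‖ ≤ ‖f‖ := by
    intro l
    by_cases hl : l.re = 1
    · obtain ⟨R, h1, -, h3⟩ := hA.exists_resolvent (l := l) (by rw [hl]; exact one_pos)
      exact ⟨R, fun _ => ⟨h1, fun f => by simpa [hl] using h3 f⟩⟩
    · exact ⟨0, fun h => absurd h hl⟩
  choose R hR using hR
  let D' : U →L[ℂ] W := ContinuousLinearMap.adjoint D
  have hD' : ∀ v : C.domain, D' v = Dst v := fun v => ext_inner_right ℂ fun w => by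
    rw [ContinuousLinearMap.adjoint_inner_left, hD]
  let J : U →ₗᵢ[ℂ] EnergySpace V X U :=
    { toFun := fun u => WithLp.toLp 2 (0, WithLp.toLp 2 (0, u))
      map_add' := fun u v => by
        rw [← WithLp.toLp_add, Prod.mk_add_mk, ← WithLp.toLp_add, Prod.mk_add_mk, add_zero,
          add_zero]
      map_smul' := fun c u => by
        rw [RingHom.id_apply, ← WithLp.toLp_smul, Prod.smul_mk, ← WithLp.toLp_smul, Prod.smul_mk,
          smul_zero, smul_zero]
      norm_map' := fun u => by
        refine (sq_eq_sq₀ (norm_nonneg _) (norm_nonneg _)).1 ?_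
        change ‖(WithLp.toLp 2 ((0 : V), WithLp.toLp 2 ((0 : X), u)))‖ ^ 2 = ‖u‖ ^ 2
        rw [WithLp.prod_norm_sq_eq_of_L2, WithLp.prod_norm_sq_eq_of_L2]
        simp }
  let Q : EnergySpace V X U →L[ℂ] U := ContinuousLinearMap.adjoint J.toContinuousLinearMap
  have hQ : ∀ z : EnergySpace V X U, Q z = z.snd.snd := fun z => ext_inner_right ℂ fun u => by
    rw [ContinuousLinearMap.adjoint_inner_left]
    change inner ℂ z (WithLp.toLp 2 ((0 : V), WithLp.toLp 2 ((0 : X), u))) = _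
    rw [WithLp.prod_inner_apply, WithLp.prod_inner_apply]
    simp
  have hQn : ∀ z, ‖Q z‖ ≤ ‖z‖ := fun z => by
    have h1 : ‖Q‖ ≤ 1 := by
      rw [LinearIsometryEquiv.norm_map]
      exact J.norm_toContinuousLinearMap_le
    simpa using Q.le_of_opNorm_le h1 z
  refine ⟨1, ‖D'‖ * ‖D‖, fun l => D'.comp (Q.comp ((R l).comp (J.toContinuousLinearMap.comp D))),
    one_pos, fun l hl => ?_⟩
  obtain ⟨h1, h2⟩ := hR l hl
  refine ⟨ContinuousLinearMap.opNorm_le_bound _ (by positivity) fun w => ?_, fun w => ?_⟩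
  · change ‖D' (Q (R l (J (D w))))‖ ≤ _
    calc ‖D' (Q (R l (J (D w))))‖ ≤ ‖D'‖ * ‖Q (R l (J (D w)))‖ := D'.le_opNorm _
      _ ≤ ‖D'‖ * ‖D w‖ := by
        gcongr
        exact (hQn _).trans ((h2 _).trans_eq (J.norm_map _))
      _ ≤ ‖D'‖ * (‖D‖ * ‖w‖) := by
        gcongr
        exact D.le_opNorm w
      _ = _ := by ring
  · refine ⟨R l (J (D w)), ?_, ?_⟩
    · have e1 := (mem_conservativeOp_graph_iff hι hd hC Dst).1 (h1 (J (D w)))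
      have e2 : IsControlledRelation ι B C Dst (0 : EnergySpace V X U) (J (D w)) w := by
        refine ⟨⟨?_, fun φ => ?_⟩, fun v => ?_⟩
        · change ι 0 = 0
          simp
        · change inner ℂ (ι φ) 0 = -(inner ℂ φ (0 : V) + B 0 φ)
          simp
        · change inner ℂ (v : U) (D w - adjointControl B 0) = inner ℂ (C v) (0 : U) + _
          rw [map_zero, sub_zero, hD, inner_zero_right, zero_add]
      simpa using e1.add e2
    · have h3 := conservativeOp_third_mem ι B C
        ⟨_, LinearPMap.mem_domain_of_mem_graph (h1 (J (D w)))⟩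
      have h4 := hC.hasDualValue hDst ⟨_, h3⟩
      rw [← hD'] at h4
      change HasDualValue C Dst _ (D' (Q (R l (J (D w)))))
      rw [hQ]
      exact h4

/-- The Hautus estimate bounds the resolvent of the damped generator on the imaginary axis. -/
theorem HasTransferFunction.exists_bound_dampedOp (hι : Function.Injective ι) (hd : DenseRange ι)
    (hC : IsSkewAdjointOp C) (hDst : IsGraphBounded C Dst)
    (hsum : IsMinusSkewMinusDDStar Chat C Dst) {β M : ℝ} {G : ℂ → W →L[ℂ] W} (hβ : 0 < β)
    (hG : HasTransferFunction ι B C Dst β M G) (hH : HautusEstimate ι B C Dst) :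
    ∃ K : ℝ, 0 ≤ K ∧ ∀ (w : ℝ) (z f : EnergySpace V X U), (z, f) ∈ (dampedOp ι B Chat).graph →
      ‖z‖ ≤ K * ‖(Complex.I * (w : ℂ)) • z - f‖ := by
  obtain ⟨δ, hδ, hH⟩ := (hautusEstimate_iff hι hd hC hDst).1 hH
  have hM : 0 ≤ M := (norm_nonneg _).trans (hG (β : ℂ) (by simp)).1
  set c := (2 / δ) * (2 * β * M + (1 + M) ^ 2) + 2 * (M / β) with hc
  have hc0 : 0 ≤ c := by positivity
  refine ⟨4 / δ + c + 1, by positivity, fun w z f hz => ?_⟩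
  obtain ⟨y, hy, hz⟩ := (mem_dampedOp_graph_iff hι hd hsum).1 hz
  set g := (Complex.I * (w : ℂ)) • z - f with hg
  have hre : ∀ z : EnergySpace V X U, (inner ℂ z ((Complex.I * (w : ℂ)) • z)).re = 0 := fun z => by
    rw [inner_smul_right, inner_self_eq_norm_sq_to_K, ← Complex.coe_algebraMap]
    simp [← Complex.ofReal_pow]
  -- The dissipation `‖D*u‖²` is the real part of `⟨z, g⟩`.
  have hyn : ‖y‖ ^ 2 ≤ ‖z‖ * ‖g‖ := by
    have h1 := hz.re_inner_eq hC hy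
    rw [inner_neg_right, Complex.neg_re] at h1
    have h2 : (inner ℂ y y).re = ‖y‖ ^ 2 := inner_self_eq_norm_sq (𝕜 := ℂ) y
    have h3 : (inner ℂ z g).re = ‖y‖ ^ 2 := by
      rw [hg, inner_sub_right, Complex.sub_re, hre, h1, h2]
      ring
    rw [← h3]
    exact (Complex.re_le_norm _).trans (norm_inner_le_norm _ _)
  set l : ℂ := β + Complex.I * w with hl
  obtain ⟨hGn, hp⟩ := hG l (by simp [hl])
  obtain ⟨p, hp, hpd⟩ := hp y
  have hpn : β * ‖p‖ ^ 2 ≤ M * ‖y‖ ^ 2 := by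
    have h1 := hp.re_inner_eq hC hpd
    have h2 : (inner ℂ p (l • p)).re = β * ‖p‖ ^ 2 := by
      have h4 : (inner ℂ p p).re = ‖p‖ ^ 2 := inner_self_eq_norm_sq (𝕜 := ℂ) p
      rw [hl, add_smul, inner_add_right, Complex.add_re, hre, inner_smul_right,
        Complex.re_ofReal_mul, h4, add_zero]
    rw [← h2, h1]
    calc (inner ℂ (G l y) y).re ≤ ‖G l y‖ * ‖y‖ :=
          (Complex.re_le_norm _).trans (norm_inner_le_norm _ _)
      _ ≤ (M * ‖y‖) * ‖y‖ := by
        gcongr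
        exact (G l).le_of_opNorm_le hGn y
      _ = _ := by ring
  -- The inputs `-y` and `y` cancel, so `z + p` is in the undamped domain and the Hautus estimate
  -- applies.
  have hsumr := hz.add hp
  rw [neg_add_cancel] at hsumr
  have hest := hH w _ _ _ hsumr (hy.add hpd)
  have e1 : (Complex.I * (w : ℂ)) • (z + p) - (f + l • p) = g - (β : ℂ) • p := by
    rw [hl, hg, smul_add, add_smul]
    abel
  rw [e1] at hest
  have n1 : ‖g - (β : ℂ) • p‖ ≤ ‖g‖ + β * ‖p‖ := by
    refine (norm_sub_le _ _).trans_eq ?_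
    rw [norm_smul, Complex.norm_real, Real.norm_of_nonneg hβ.le]
  have n2 : ‖y + G l y‖ ≤ (1 + M) * ‖y‖ := by
    refine (norm_add_le _ _).trans ?_
    have := (G l).le_of_opNorm_le hGn y
    linarith
  have n3 : ‖z‖ ≤ ‖z + p‖ + ‖p‖ := by
    simpa using norm_sub_le (z + p) p
  have m1 : ‖g - (β : ℂ) • p‖ ^ 2 ≤ 2 * ‖g‖ ^ 2 + 2 * β * (M * ‖y‖ ^ 2) := by
    calc ‖g - (β : ℂ) • p‖ ^ 2 ≤ (‖g‖ + β * ‖p‖) ^ 2 := by gcongr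
      _ ≤ 2 * ‖g‖ ^ 2 + 2 * β * (β * ‖p‖ ^ 2) := by nlinarith [sq_nonneg (‖g‖ - β * ‖p‖)]
      _ ≤ _ := by gcongr
  have m2 : ‖y + G l y‖ ^ 2 ≤ (1 + M) ^ 2 * ‖y‖ ^ 2 := by
    rw [← mul_pow]
    gcongr
  have m3 : ‖p‖ ^ 2 ≤ M / β * ‖y‖ ^ 2 := by
    rw [div_mul_eq_mul_div, le_div_iff₀ hβ]
    linarith
  have m4 : ‖z + p‖ ^ 2 ≤
      1 / δ * (2 * ‖g‖ ^ 2 + 2 * β * (M * ‖y‖ ^ 2) + (1 + M) ^ 2 * ‖y‖ ^ 2) := by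
    rw [one_div, le_inv_mul_iff₀ hδ]
    linarith
  have m5 : ‖z‖ ^ 2 ≤ 4 / δ * ‖g‖ ^ 2 + c * ‖y‖ ^ 2 := by
    calc ‖z‖ ^ 2 ≤ (‖z + p‖ + ‖p‖) ^ 2 := by gcongr
      _ ≤ 2 * ‖z + p‖ ^ 2 + 2 * ‖p‖ ^ 2 := by nlinarith [sq_nonneg (‖z + p‖ - ‖p‖)]
      _ ≤ 2 * (1 / δ * (2 * ‖g‖ ^ 2 + 2 * β * (M * ‖y‖ ^ 2) + (1 + M) ^ 2 * ‖y‖ ^ 2)) +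
          2 * (M / β * ‖y‖ ^ 2) := by gcongr
      _ = _ := by rw [hc]; ring
  have m6 : ‖z‖ ^ 2 ≤ 4 / δ * ‖g‖ ^ 2 + c * (‖z‖ * ‖g‖) := by
    have := mul_le_mul_of_nonneg_left hyn hc0
    linarith
  exact le_mul_of_sq_le (norm_nonneg _) (norm_nonneg _) (by positivity) hc0 m6

/-- A resolvent bound for the damped generator on the imaginary axis implies the Hautus
estimate. -/
theorem HasTransferFunction.hautusEstimate [CompleteSpace W] (hι : Function.Injective ι)
    (hd : DenseRange ι) (hC : IsSkewAdjointOp C) (hDst : IsGraphBounded C Dst)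
    (hsum : IsMinusSkewMinusDDStar Chat C Dst) {β M K : ℝ} {G : ℂ → W →L[ℂ] W} (hβ : 0 < β)
    (hG : HasTransferFunction ι B C Dst β M G) (hK0 : 0 ≤ K)
    (hK : ∀ (w : ℝ) (z f : EnergySpace V X U), (z, f) ∈ (dampedOp ι B Chat).graph →
      ‖z‖ ≤ K * ‖(Complex.I * (w : ℂ)) • z - f‖) : HautusEstimate ι B C Dst := by
  rw [hautusEstimate_iff hι hd hC hDst]
  set c := 2 * K ^ 2 + (1 + K * β) ^ 2 / (2 * β) + 1 with hc
  have hc0 : 0 < c := by positivity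
  refine ⟨1 / c, by positivity, fun w z f y hz hy => ?_⟩
  have hre : ∀ z : EnergySpace V X U, (inner ℂ z ((Complex.I * (w : ℂ)) • z)).re = 0 := fun z => by
    rw [inner_smul_right, inner_self_eq_norm_sq_to_K, ← Complex.coe_algebraMap]
    simp [← Complex.ofReal_pow]
  set g := (Complex.I * (w : ℂ)) • z - f with hg
  set l : ℂ := β + Complex.I * w with hl
  have hln : ∀ q : EnergySpace V X U, (inner ℂ q (l • q)).re = β * ‖q‖ ^ 2 := fun q => by
    have h4 : (inner ℂ q q).re = ‖q‖ ^ 2 := inner_self_eq_norm_sq (𝕜 := ℂ) q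
    rw [hl, add_smul, inner_add_right, Complex.add_re, hre, inner_smul_right,
      Complex.re_ofReal_mul, h4, add_zero]
  obtain ⟨-, hp⟩ := hG l (by simp [hl])
  -- `z - q` satisfies the feedback law when its output `y - G l v` equals `v`, so `v = (1 + G l)⁻¹
  -- y`. Accretivity holds because `Re ⟨G l v, v⟩ = β ‖p‖²`.
  obtain ⟨R, hR⟩ := ContinuousLinearMap.exists_one_add_inverse (G l) fun v => by
    obtain ⟨p, h1, h2⟩ := hp v
    have h3 : (inner ℂ v (G l v)).re = (inner ℂ (G l v) v).re := inner_re_symm (𝕜 := ℂ) _ _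
    rw [h3, ← h1.re_inner_eq hC h2, hln]
    positivity
  set v := R y
  have hv : y - G l v = v := sub_eq_of_eq_add (hR y).symm
  obtain ⟨q, hq, hqd⟩ := hp v
  -- `Re ⟨y - v, v⟩ ≤ ‖y‖ ‖v‖ - ‖v‖² ≤ ‖y‖² / 4`, so no bound on `G` is used here.
  have hqn : β * ‖q‖ ^ 2 ≤ ‖y‖ ^ 2 / 4 := by
    have h1 := hq.re_inner_eq hC hqd
    rw [hln, ← sub_eq_iff_eq_add'.2 (hR y).symm, inner_sub_left, Complex.sub_re] at h1
    have h2 : (inner ℂ v v).re = ‖v‖ ^ 2 := inner_self_eq_norm_sq (𝕜 := ℂ) v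
    have h3 : (inner ℂ y v).re ≤ ‖y‖ * ‖v‖ :=
      (Complex.re_le_norm _).trans (norm_inner_le_norm _ _)
    rw [h2] at h1
    nlinarith [sq_nonneg (‖y‖ / 2 - ‖v‖)]
  have hmem : (z - q, f - l • q) ∈ (dampedOp ι B Chat).graph := by
    refine (mem_dampedOp_graph_iff hι hd hsum).2 ⟨v, ?_, ?_⟩
    · have := hy.add hqd.neg
      rw [← sub_eq_add_neg y, hv] at this
      rw [sub_eq_add_neg z]
      exact this
    · have := hz.add hq.neg
      rw [zero_add] at this
      rw [sub_eq_add_neg, sub_eq_add_neg]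
      exact this
  have h1 := hK w _ _ hmem
  have e1 : (Complex.I * (w : ℂ)) • (z - q) - (f - l • q) = g + (β : ℂ) • q := by
    rw [hl, hg, smul_sub, add_smul]
    abel
  rw [e1] at h1
  have n1 : ‖g + (β : ℂ) • q‖ ≤ ‖g‖ + β * ‖q‖ := by
    refine (norm_add_le _ _).trans_eq ?_
    rw [norm_smul, Complex.norm_real, Real.norm_of_nonneg hβ.le]
  have n2 : ‖z‖ ≤ K * ‖g‖ + (1 + K * β) * ‖q‖ := by
    have h2 : ‖z‖ ≤ ‖z - q‖ + ‖q‖ := by simpa using norm_add_le (z - q) q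
    have h3 := mul_le_mul_of_nonneg_left n1 hK0
    linarith
  have n3 : ‖q‖ ^ 2 ≤ ‖y‖ ^ 2 / (4 * β) := by
    rw [le_div_iff₀ (by positivity)]
    linarith
  have n4 : ‖z‖ ^ 2 ≤ 2 * K ^ 2 * ‖g‖ ^ 2 + (1 + K * β) ^ 2 / (2 * β) * ‖y‖ ^ 2 := by
    calc ‖z‖ ^ 2 ≤ (K * ‖g‖ + (1 + K * β) * ‖q‖) ^ 2 := by gcongr
      _ ≤ 2 * K ^ 2 * ‖g‖ ^ 2 + 2 * (1 + K * β) ^ 2 * ‖q‖ ^ 2 := by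
        nlinarith [sq_nonneg (K * ‖g‖ - (1 + K * β) * ‖q‖)]
      _ ≤ 2 * K ^ 2 * ‖g‖ ^ 2 + 2 * (1 + K * β) ^ 2 * (‖y‖ ^ 2 / (4 * β)) := by gcongr
      _ = _ := by field_simp; ring
  rw [one_div, inv_mul_le_iff₀ hc0]
  have k1 : 0 ≤ (1 + K * β) ^ 2 / (2 * β) := by positivity
  rw [hc]
  nlinarith [sq_nonneg ‖g‖, sq_nonneg ‖y‖, mul_nonneg k1 (sq_nonneg ‖g‖),
    mul_nonneg (sq_nonneg K) (sq_nonneg ‖y‖)]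

end Stabilization

theorem mainTheorem3 {V X U W : Type*}
    [NormedAddCommGroup V] [InnerProductSpace ℂ V] [CompleteSpace V]
    [NormedAddCommGroup X] [InnerProductSpace ℂ X] [CompleteSpace X]
    [NormedAddCommGroup U] [InnerProductSpace ℂ U] [CompleteSpace U]
    [NormedAddCommGroup W] [InnerProductSpace ℂ W] [CompleteSpace W]
    (ι : V →L[ℂ] X) (hι : Function.Injective ι) (hιd : DenseRange ι)
    (B : U →L[ℂ] (V →L⋆[ℂ] ℂ))
    (Chat C : U →ₗ.[ℂ] U) (hChat : IsMDissipativeOp Chat) (hC : IsSkewAdjointOp C)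
    (Dst : C.domain →ₗ[ℂ] W) (hDst : IsGraphBounded C Dst)
    (hsum : IsMinusSkewMinusDDStar Chat C Dst)
    (hH : TransferEstimate ι B C Dst ∨ IsBoundedControl C Dst) :
    IsExponentiallyStable (dampedOp ι B Chat) ↔ HautusEstimate ι B C Dst := by
  have hT : IsMDissipativeOp (dampedOp ι B Chat) := hChat.systemOp hι hιd
  obtain ⟨β, M, G, hβ, hG⟩ : ∃ β M G, 0 < β ∧ HasTransferFunction ι B C Dst β M G :=
    hH.elim (fun h => h.hasTransferFunction) fun h => h.hasTransferFunction hι hιd hC hDst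
  constructor
  · intro h
    obtain ⟨K, hK0, hK⟩ := hT.exists_bound_of_isExponentiallyStable h
    exact hG.hautusEstimate hι hιd hC hDst hsum hβ hK0 hK
  · intro h
    obtain ⟨K, hK0, hK⟩ := hG.exists_bound_dampedOp hι hιd hC hDst hsum hβ h
    exact hT.isExponentiallyStable hK0 hK
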